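/- **Setting.** There are $N$ agents; agent $i$ chooses $x_i\in\Omega_i\subseteq\mathbb R^{n_i}$, and $\boldsymbol x=\operatorname{col}(x_1,\dots,x_N)\in\mathbb R^n$, $\boldsymbol\Omega=\prod_i\Omega_i$. Let $\xi$ be an $\mathbb R^d$-valued random variable, $J_i:\mathbb R^n\times\mathbb R^d\to\mathbb R$ measurable, $\mathbb J_i(\boldsymbol x)=\mathbb E[J_i(\boldsymbol x,\xi)]$, $\boldsymbol{\mathcal X}=\{\boldsymbol x\in\boldsymbol\Omega: \sum_iA_ix_i\le b\}$ with $A_i\in\mathbb R^{m\times n_i}$, $b\in\mathbb R^m$, and let $\mathbb F(\boldsymbol x)=\operatorname{col}(\mathbb E[\nabla_{x_i}J_i(x_i,\boldsymbol x_{-i},\xi)])_i$ be the pseudogradient. A stochastic generalized Nash equilibrium (SGNE) is an $\boldsymbol x^*\in\boldsymbol{\mathcal X}$ such that, for each $i$, $\mathbb J_i(\boldsymbol x^*)\le\mathbb J_i(y,\boldsymbol x^*_{-i})$ for all $y\in\Omega_i$ with $A_iy\le b-\sum_{j\ne i}A_jx_j^*$. It is variational (v-SGNE) if moreover $\langle\mathbb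 F(\boldsymbol x^*),\boldsymbol x-\boldsymbol x^*\rangle\ge0$ for all $\boldsymbol x\in\boldsymbol{\mathcal X}$. **Assumptions.** 1. *Costs.* For each $i$ and all $\boldsymbol x\in\boldsymbol\Omega$: $J_i(\boldsymbol x,\xi)$ is integrable; $\mathbb J_i(\cdot,\boldsymbol x_{-i})$ is convex and $C^1$ on $\Omega_i$; for every $u$, $J_i(\cdot,\boldsymbol x_{-i},u)$ is convex and $\ell_i(\boldsymbol x_{-i},u)$-Lipschitz on $\Omega_i$, with $\ell_i(\boldsymbol x_{-i},\xi)$ integrable. For all $\boldsymbol x\in\mathbb R^n$, $J_i(\cdot,\boldsymbol x_{-i},u)$ is $C^1$ on $\mathbb R^{n_i}$ for every $u$, and $\nabla_{x_i}J_i(\boldsymbol x,\xi)$ is integrable (so $\mathbb F$ is defined on $\mathbb R^n$). 2. *Constraints.* Each $\Omega_i$ is nonempty, compact and convex, and some $\boldsymbol x\in\boldsymbol\Omega$ satisfies $\sum_iA_ix_i<b$ componentwise. 3. *Graph.* $W=(w_{ij})$ is the symmetric weighted adjacency matrix (positive weights on the edges, zero elsewhere) of an undirected connected graph on the agents; $d_i=\sum_jw_{ij}$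 and $L=\operatorname{diag}(d_i)-W$. 4. *Cocoercivity.* For some $\beta>0$ and all $\boldsymbol x,\boldsymbol y\in\mathbb R^n$, $\langle\mathbb F(\boldsymbol x)-\mathbb F(\boldsymbol y),\boldsymbol x-\boldsymbol y\rangle\ge\beta\|\mathbb F(\boldsymbol x)-\mathbb F(\boldsymbol y)\|^2$. 5. *Step sizes.* Let $0<\theta\le\min\{1/(2\max_id_i),\beta\}$ (with $1/0=+\infty$). For some $\tau>0$ and all $i$, $$0<\alpha_i\le\Big(\max_j\sum_k|[A_i^\top]_{jk}|+\tau\Big)^{-1},\quad 0<\nu_i\le(2d_i+\tau)^{-1},\quad 0<\sigma_i\le\Big(\max_j\sum_k|[A_i]_{jk}|+2d_i+\tau\Big)^{-1},$$ so that, with $\mathbf A=\operatorname{diag}\{A_1,\dots,A_N\}$ and $\mathbf L=L\otimes I_m$, the symmetric matrix $$\Psi=\begin{bmatrix}\alpha^{-1}&0&-\mathbf A^\top\\0&\nu^{-1}&-\mathbf L\\-\mathbf A&-\mathbf L&\sigma^{-1}\end{bmatrix}$$ is diagonally dominant, hence positive definite. Moreover its inverse has spectral norm $|\Psi^{-1}|<\theta/8$.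 **Algorithm (SpPRG).** Let $\sum_ib_i=b$ with $b_i\in\mathbb R^m$. At iteration $k$ agent $i$ has $N_k$ samples $\xi_i^{k,1},\dots,\xi_i^{k,N_k}$; for each agent the samples (over all iterations) are i.i.d. copies of $\xi$. Put $F_i^{\rm SA}(\boldsymbol x,k)=\frac1{N_k}\sum_{t=1}^{N_k}\nabla_{x_i}J_i(\boldsymbol x,\xi_i^{k,t})$. From (possibly random) $x_i^0\in\Omega_i$, $\lambda_i^0\in\mathbb R^m_{\ge0}$, $z_i^0\in\mathbb R^m$, $x_i^{-1}\in\mathbb R^{n_i}$, $\lambda_i^{-1}\in\mathbb R^m$, set $\tilde x_i^k=2x_i^k-x_i^{k-1}$, $\tilde\lambda_i^k=2\lambda_i^k-\lambda_i^{k-1}$ and $$\begin{aligned}x_i^{k+1}&=\operatorname{proj}_{\Omega_i}\big[x_i^k-\alpha_i\big(F_i^{\rm SA}(\tilde{\boldsymbol x}^k,k)+A_i^\top\lambda_i^k\big)\big],\qquad z_i^{k+1}=z_i^k-\nu_i\sum_jw_{ij}(\lambda_i^k-\lambda_j^k),\\ \lambda_i^{k+1}&=\operatorname{proj}_{\mathbb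 R^m_{\ge0}}\Big[\lambda_i^k+\sigma_i\big(A_i(2x_i^{k+1}-x_i^k)-b_i\big)+\sigma_i\sum_jw_{ij}\big(2(z_i^{k+1}-z_j^{k+1})-(z_i^k-z_j^k)\big)-\sigma_i\sum_jw_{ij}(\tilde\lambda_i^k-\tilde\lambda_j^k)\Big].\end{aligned}$$ 6. *Stochastic error.* Let $\epsilon^k=F^{\rm SA}(\tilde{\boldsymbol x}^k,k)-\mathbb F(\tilde{\boldsymbol x}^k)$, and let $\mathcal F_k$ be the $\sigma$-algebra generated by the initial variables and the samples of the iterations before $k$. For all $k\ge0$, $\epsilon^k$ is square integrable and $\mathbb E[\epsilon^k\mid\mathcal F_k]=0$ a.s. 7. *Variance reduction.* There are $c,k_0,a>0$, $C>0$ and $\varsigma\in\mathbb R$ such that for all $k\ge0$: $N_k\ge c(k+k_0)^{a+1}$ and $\mathbb E[\|\epsilon^k\|^2\mid\mathcal F_k]\le C\varsigma^2/N_k$ a.s. **Theorem.** Under these assumptions the sequence $(\boldsymbol x^k)_{k\in\mathbb N}$ generated by SpPRG converges almost surely to a v-SGNE (the limit may depend on the realization). -/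

import Mathlib

open MeasureTheory ProbabilityTheory Filter Topology
open scoped Matrix Kronecker NNReal

noncomputable section

namespace SGNEP

/-- Euclidean space of dimension `k`. -/
abbrev Euc (k : ℕ) : Type := EuclideanSpace ℝ (Fin k)

/-- Collective decisions `x = col(x_1, …, x_N)`, with the Euclidean structure of `ℝ^(n_1 + … + n_N)`. -/
abbrev Profile {N : ℕ} (n : Fin N → ℕ) : Type := PiLp 2 (fun i : Fin N => Euc (n i))

/-- Stacked variables `col(λ_1, …, λ_N)` with one vector of `ℝ^m` for each agent. -/
abbrev Dual (N m : ℕ) : Type := Fin N → Euc m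

/-- The profile `(y, x_{-i})`. -/
def replace {N : ℕ} {n : Fin N → ℕ} (x : Profile n) (i : Fin N) (y : Euc (n i)) : Profile n :=
  WithLp.toLp 2 (Function.update (WithLp.ofLp x) i y)

/-- The product of a matrix and a vector, as a map of Euclidean spaces. -/
def mulE {p q : ℕ} (M : Matrix (Fin p) (Fin q) ℝ) (v : Euc q) : Euc p :=
  WithLp.toLp 2 (M *ᵥ WithLp.ofLp v)

/-- The projection `argmin_{q ∈ C} ‖q - p‖`; for nonempty closed convex `C` the minimizer exists
and is unique. -/
def proj {k : ℕ} (C : Set (Euc k)) (p : Euc k) : Euc k :=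
  Classical.epsilon fun q => q ∈ C ∧ ∀ y ∈ C, ‖q - p‖ ≤ ‖y - p‖

/-- The nonnegative orthant of `ℝ^m`. -/
def orthant (m : ℕ) : Set (Euc m) := {v | ∀ r, 0 ≤ v r}

/-- The data of a game with `N` agents, decision dimensions `n_i`, `m` shared affine constraints
`∑ A_i x_i ≤ b` and uncertainty in `ℝ^d`: sample costs `J_i(x, u)` and local sets `Ω_i`. -/
structure Game (N m d : ℕ) (n : Fin N → ℕ) where
  J : Fin N → Profile n → Euc d → ℝ
  Ω : (i : Fin N) → Set (Euc (n i))
  A : (i : Fin N) → Matrix (Fin m) (Fin (n i)) ℝ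
  b : Euc m

namespace Game

variable {N m d : ℕ} {n : Fin N → ℕ} (G : Game N m d n)

/-- `A x = ∑ A_i x_i`. -/
def coupling (x : Profile n) : Euc m := ∑ i, mulE (G.A i) (x i)

/-- `Ω = ∏ Ω_i`. -/
def localSet : Set (Profile n) := {x | ∀ i, x i ∈ G.Ω i}

/-- The collective feasible set `{x ∈ Ω | A x ≤ b}`. -/
def feasible : Set (Profile n) := {x | x ∈ G.localSet ∧ ∀ r, G.coupling x r ≤ G.b r}

/-- The feasible set of agent `i`:
`{y ∈ Ω_i | A_i y ≤ b - ∑_{j ≠ i} A_j x_j}`. -/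
def feasibleFor (i : Fin N) (x : Profile n) : Set (Euc (n i)) :=
  {y | y ∈ G.Ω i ∧
    ∀ r, mulE (G.A i) y r ≤ G.b r - ∑ j ∈ Finset.univ.erase i, mulE (G.A j) (x j) r}

/-- The partial gradient `∇_{x_i} J_i(x_i, x_{-i}, u)`. -/
def partialGrad (i : Fin N) (x : Profile n) (u : Euc d) : Euc (n i) :=
  gradient (fun y => G.J i (replace x i y) u) (x i)

section Expectation

variable {Ξ : Type*} [MeasurableSpace Ξ] (P : Measure Ξ) (ξ : Ξ → Euc d)

/-- The expected-value cost `E[J_i(x, ξ)]`. -/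
def expCost (i : Fin N) (x : Profile n) : ℝ := ∫ w, G.J i x (ξ w) ∂P

/-- The pseudogradient `F(x) = col(E[∇_{x_i} J_i(x, ξ)])`. -/
def pseudograd (x : Profile n) : Profile n :=
  WithLp.toLp 2 fun i => ∫ w, G.partialGrad i x (ξ w) ∂P

/-- Stochastic generalized Nash equilibria. -/
def IsSGNE (x : Profile n) : Prop :=
  x ∈ G.feasible ∧
    ∀ i, ∀ y ∈ G.feasibleFor i x, G.expCost P ξ i x ≤ G.expCost P ξ i (replace x i y)

/-- Solutions of the stochastic variational inequality on the collective feasible set. -/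
def SolvesSVI (x : Profile n) : Prop :=
  x ∈ G.feasible ∧ ∀ y ∈ G.feasible, 0 ≤ inner ℝ (G.pseudograd P ξ x) (y - x)

/-- Variational equilibria: the equilibria that solve the variational inequality. -/
def IsVariationalSGNE (x : Profile n) : Prop :=
  G.IsSGNE P ξ x ∧ G.SolvesSVI P ξ x

/-- Standing assumptions on the costs. Smoothness of the sample costs and existence of the
expected gradient are required on the whole space because the algorithm evaluates gradients at
reflected points, which may leave `Ω`. -/
structure CostAssumption : Prop where
  measurable : ∀ i, Measurable fun q : Profile n × Euc d => G.J i q.1 q.2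
  integrable : ∀ i, ∀ x ∈ G.localSet, Integrable (fun w => G.J i x (ξ w)) P
  expCost_convex : ∀ i, ∀ x ∈ G.localSet,
    ConvexOn ℝ (G.Ω i) fun y => G.expCost P ξ i (replace x i y)
  expCost_contDiff : ∀ i, ∀ x ∈ G.localSet,
    ContDiffOn ℝ 1 (fun y => G.expCost P ξ i (replace x i y)) (G.Ω i)
  convex : ∀ i, ∀ x ∈ G.localSet, ∀ u, ConvexOn ℝ (G.Ω i) fun y => G.J i (replace x i y) u
  contDiff : ∀ i (x : Profile n) u, ContDiff ℝ 1 fun y => G.J i (replace x i y) u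
  lipschitz : ∀ i, ∀ x ∈ G.localSet, ∃ ℓ : Euc d → ℝ≥0,
    Integrable (fun w => (ℓ (ξ w) : ℝ)) P ∧
      ∀ u, LipschitzOnWith (ℓ u) (fun y => G.J i (replace x i y) u) (G.Ω i)
  grad_integrable : ∀ i (x : Profile n), Integrable (fun w => G.partialGrad i x (ξ w)) P

/-- `F` is `β`-cocoercive. -/
def IsCocoercive (β : ℝ) : Prop :=
  ∀ x y : Profile n,
    β * ‖G.pseudograd P ξ x - G.pseudograd P ξ y‖ ^ 2 ≤
      inner ℝ (G.pseudograd P ξ x - G.pseudograd P ξ y) (x - y)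

end Expectation

/-- Standing assumptions on the constraints: nonempty compact convex local sets, and Slater's
condition. -/
structure ConstraintAssumption : Prop where
  nonempty : ∀ i, (G.Ω i).Nonempty
  compact : ∀ i, IsCompact (G.Ω i)
  convex : ∀ i, Convex ℝ (G.Ω i)
  slater : ∃ x ∈ G.localSet, ∀ r, G.coupling x r < G.b r

end Game

/-- `W` is a symmetric weighted adjacency matrix of an undirected connected graph. -/
structure GraphAssumption {N : ℕ} (𝒢 : SimpleGraph (Fin N)) (W : Matrix (Fin N) (Fin N) ℝ) :
    Prop where
  connected : 𝒢.Connected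
  symm : W.IsSymm
  pos : ∀ i j, 𝒢.Adj i j → 0 < W i j
  zero : ∀ i j, ¬ 𝒢.Adj i j → W i j = 0

/-- The weighted degree `d_i`. -/
def degree {N : ℕ} (W : Matrix (Fin N) (Fin N) ℝ) (i : Fin N) : ℝ := ∑ j, W i j

/-- The weighted Laplacian `L = D - W`. -/
def laplacian {N : ℕ} (W : Matrix (Fin N) (Fin N) ℝ) : Matrix (Fin N) (Fin N) ℝ :=
  Matrix.diagonal (degree W) - W

/-- The step sizes `α_i`, `ν_i`, `σ_i`. -/
structure StepSizes (N : ℕ) where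
  α : Fin N → ℝ
  ν : Fin N → ℝ
  σ : Fin N → ℝ

section Preconditioning

variable {N m : ℕ} {n : Fin N → ℕ}

/-- The block diagonal matrix `diag{A_1, …, A_N}`. -/
def blockA (A : (i : Fin N) → Matrix (Fin m) (Fin (n i)) ℝ) :
    Matrix (Fin N × Fin m) ((i : Fin N) × Fin (n i)) ℝ :=
  Matrix.of fun p q => if p.1 = q.1 then A q.1 p.2 q.2 else 0

/-- The preconditioning matrix `Ψ`. -/
def precond (A : (i : Fin N) → Matrix (Fin m) (Fin (n i)) ℝ) (W : Matrix (Fin N) (Fin N) ℝ)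
    (γ : StepSizes N) :
    Matrix (((i : Fin N) × Fin (n i)) ⊕ ((Fin N × Fin m) ⊕ (Fin N × Fin m)))
      (((i : Fin N) × Fin (n i)) ⊕ ((Fin N × Fin m) ⊕ (Fin N × Fin m))) ℝ :=
  let L : Matrix (Fin N × Fin m) (Fin N × Fin m) ℝ :=
    laplacian W ⊗ₖ (1 : Matrix (Fin m) (Fin m) ℝ)
  Matrix.fromBlocks
    (Matrix.diagonal fun q => (γ.α q.1)⁻¹) (Matrix.fromCols 0 (-(blockA A)ᵀ))
    (Matrix.fromRows 0 (-(blockA A)))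
    (Matrix.fromBlocks (Matrix.diagonal fun p => (γ.ν p.1)⁻¹) (-L)
      (-L) (Matrix.diagonal fun p => (γ.σ p.1)⁻¹))

/-- The step-size condition: diagonal dominance of `Ψ` with margin `τ`, and spectral norm of
`Ψ⁻¹` smaller than `θ / 8`, where `θ` is a cocoercivity constant of the extended forward operator,
that is `0 < θ ≤ min {1 / (2 max_i d_i), β}` (and `0 < θ ≤ β` if all degrees vanish).
A bound by the inverse of a maximum over rows is written as one bound for each row. -/
structure StepAssumption (A : (i : Fin N) → Matrix (Fin m) (Fin (n i)) ℝ)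
    (W : Matrix (Fin N) (Fin N) ℝ) (β θ τ : ℝ) (γ : StepSizes N) : Prop where
  θ_pos : 0 < θ
  θ_le : θ ≤ β
  θ_deg : ∀ i, 2 * degree W i * θ ≤ 1
  τ_pos : 0 < τ
  α_pos : ∀ i, 0 < γ.α i
  α_le : ∀ i j, γ.α i ≤ (∑ k, |(A i)ᵀ j k| + τ)⁻¹
  ν_pos : ∀ i, 0 < γ.ν i
  ν_le : ∀ i, γ.ν i ≤ (2 * degree W i + τ)⁻¹
  σ_pos : ∀ i, 0 < γ.σ i
  σ_le : ∀ i j, γ.σ i ≤ (∑ k, |A i j k| + 2 * degree W i + τ)⁻¹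
  norm_inv_lt : ‖Matrix.toEuclideanCLM (𝕜 := ℝ) (precond A W γ)⁻¹‖ < θ / 8

end Preconditioning

/-- The variables held at iteration `k`: `x^k`, `z^k`, `λ^k`, and the previous `x^{k-1}`,
`λ^{k-1}`. -/
structure State (N m : ℕ) (n : Fin N → ℕ) where
  x : Profile n
  z : Dual N m
  l : Dual N m
  xPrev : Profile n
  lPrev : Dual N m

namespace State

variable {N m : ℕ} {n : Fin N → ℕ}

/-- The reflected decision `2 x^k - x^{k-1}`. -/
def xRefl (s : State N m n) : Profile n := (2 : ℝ) • s.x - s.xPrev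

/-- The reflected multipliers `2 λ^k - λ^{k-1}`. -/
def lRefl (s : State N m n) : Dual N m := (2 : ℝ) • s.l - s.lPrev

end State

namespace Game

variable {N m d : ℕ} {n : Fin N → ℕ} (G : Game N m d n)

/-- One iteration of the preconditioned algorithm, with `Fhat` in place of the pseudogradient and
local constraint vectors `b_i`. -/
def step (W : Matrix (Fin N) (Fin N) ℝ) (γ : StepSizes N) (bl : Dual N m)
    (Fhat : Profile n → Profile n) (s : State N m n) : State N m n :=
  let x' : Profile n := WithLp.toLp 2 fun i =>
    proj (G.Ω i) (s.x i - γ.α i • (Fhat s.xRefl i + mulE (G.A i)ᵀ (s.l i)))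
  let z' : Dual N m := fun i => s.z i - γ.ν i • ∑ j, W i j • (s.l i - s.l j)
  let l' : Dual N m := fun i =>
    proj (orthant m) (s.l i
      + γ.σ i • (mulE (G.A i) ((2 : ℝ) • x' i - s.x i) - bl i)
      + γ.σ i • ∑ j, W i j • ((2 : ℝ) • (z' i - z' j) - (s.z i - s.z j))
      - γ.σ i • ∑ j, W i j • (s.lRefl i - s.lRefl j))
  { x := x', z := z', l := l', xPrev := s.x, lPrev := s.l }

section Sampling

variable {Ξ : Type*} {batch : ℕ → ℕ}
  (sample : (k : ℕ) → Fin N → Fin (batch k) → Ξ → Euc d)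

/-- The sample average `F^SA` with the samples drawn at iteration `k`: agent `i` averages
`∇_{x_i} J_i` over its own `batch k` samples. -/
def sampleAverage (k : ℕ) (w : Ξ) (x : Profile n) : Profile n :=
  WithLp.toLp 2 fun i => (batch k : ℝ)⁻¹ • ∑ t, G.partialGrad i x (sample k i t w)

/-- The iterates of the preconditioned algorithm started at `init`. -/
def iterate (W : Matrix (Fin N) (Fin N) ℝ) (γ : StepSizes N) (bl : Dual N m)
    (init : Ξ → State N m n) : ℕ → Ξ → State N m n
  | 0, w => init w
  | k + 1, w =>
      G.step W γ bl (G.sampleAverage sample k w) (iterate W γ bl init k w)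

/-- The stochastic error at iteration `k`, at the point where the algorithm evaluates `F^SA`. -/
def error [MeasurableSpace Ξ] (P : Measure Ξ) (ξ : Ξ → Euc d)
    (W : Matrix (Fin N) (Fin N) ℝ) (γ : StepSizes N) (bl : Dual N m)
    (init : Ξ → State N m n) (k : ℕ) (w : Ξ) : Profile n :=
  let y := (G.iterate sample W γ bl init k w).xRefl
  G.sampleAverage sample k w y - G.pseudograd P ξ y

end Sampling

end Game

section Information

variable {N m d : ℕ} {n : Fin N → ℕ} {Ξ : Type*} {batch : ℕ → ℕ}

/-- All initial variables as one random vector. -/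
def initVector (init : Ξ → State N m n) (w : Ξ) :
    Profile n × Dual N m × Dual N m × Profile n × Dual N m :=
  ((init w).x, (init w).z, (init w).l, (init w).xPrev, (init w).lPrev)

/-- The information available at the beginning of iteration `k`: the σ-algebra generated by the
initial variables and by the samples drawn at the iterations before `k`. -/
@[reducible]
def info (sample : (k : ℕ) → Fin N → Fin (batch k) → Ξ → Euc d) (init : Ξ → State N m n)
    (k : ℕ) : MeasurableSpace Ξ :=
  MeasurableSpace.comap (initVector init) inferInstance ⊔
    ⨆ (j : ℕ) (_ : j < k) (i : Fin N) (t : Fin (batch j)),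
      MeasurableSpace.comap (sample j i t) inferInstance

end Information

/-- For each agent, the samples are i.i.d. copies of `ξ`, over all iterations and batches. -/
structure SamplingAssumption {N d : ℕ} {Ξ : Type*} [MeasurableSpace Ξ] (P : Measure Ξ)
    (ξ : Ξ → Euc d) {batch : ℕ → ℕ} (sample : (k : ℕ) → Fin N → Fin (batch k) → Ξ → Euc d) :
    Prop where
  measurable : ∀ k i t, Measurable (sample k i t)
  identDistrib : ∀ k i t, IdentDistrib (sample k i t) ξ P P
  indep : ∀ i, iIndepFun (fun p : (k : ℕ) × Fin (batch k) => sample p.1 i p.2) P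

end SGNEP

end

noncomputable section

namespace SGNEP

/-! A variational equilibrium is obtained from a variational inequality for triples `u = (x, z, λ)`
with `x ∈ Ω` and all `λ_i ≥ 0`: its operator is `B + S`, where `B u = (F x, 0, Lλ + (b_i))` is
`θ`-cocoercive and `S` is linear and skew. The auxiliary variable `z` is unconstrained, and this
forces `Lλ = 0`, so that by connectedness all agents hold the same multiplier. Solutions project
onto solutions of the original variational inequality (`solvesSVI_of_kkt`), and such triples exist
(`exists_kkt`). Convexity of the sample costs then turns a solution into a Nash equilibrium.

In these variables one iteration is a preconditioned reflected forward-backward step: `Ψ (u_k -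
u_{k+1}) - B (2 u_k - u_{k-1}) - e_k - S u_{k+1}` lies in the normal cone at `u_{k+1}`
(`step_inner_le`). Since `‖Ψ⁻¹‖ < θ / 8`, the form of `Ψ` dominates `8 / θ` times the squared norm.
For every solution `p` the energy `‖u_k - p‖²_Ψ + ‖u_k - u_{k-1}‖²_Ψ / 8` therefore decreases by
`3/4 ‖u_{k+1} - u_k‖²_Ψ`, up to the noise term `-2 ⟪e_k, u_{k+1} - p⟫` (`reflected_step_descent`).
If the partial sums of the noise terms converge for each `p` and `e_k → 0`, an Opial argument gives
convergence of `u_k` (`reflected_forward_backward_tendsto`). That part is deterministic and is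
applied to one realization at a time.

Probability enters only through the noise sums. The decision `x^{k+1}` depends on the noise, so it
is compared with the update `nextX` that uses the exact pseudogradient. The difference is `O(‖ε_k‖)`
and contributes an absolutely summable term, because `∑ E‖ε_k‖² < ∞` by the growth of the batches.
The exact update is bounded and known before the samples of iteration `k` are drawn, so its
contribution is an `L²`-bounded martingale (`ae_tendsto_sum_inner`). The terms `⟪ε_k, p⟫` are
handled on an orthonormal basis, which makes the exceptional null set independent of `p`. -/

theorem norm_sub_le_of_obtuse {H : Type*} [NormedAddCommGroup H] [InnerProductSpace ℝ H]
    {p q p' q' : H} (hp : inner ℝ (p - p') (q' - p') ≤ 0)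
    (hq : inner ℝ (q - q') (p' - q') ≤ 0) : ‖p' - q'‖ ≤ ‖p - q‖ := by
  -- The sum of the two obtuse-angle conditions is firm nonexpansiveness; Cauchy-Schwarz then
  -- finishes.
  have key : ‖p' - q'‖ ^ 2 ≤ inner ℝ (p - q) (p' - q') := by
    have : inner ℝ (p - q) (p' - q') - ‖p' - q'‖ ^ 2
        = - inner ℝ (p - p') (q' - p') - inner ℝ (q - q') (p' - q') := by
      rw [← real_inner_self_eq_norm_sq]
      simp only [inner_sub_left, inner_sub_right, real_inner_comm]
      ring
    linarith
  have h3 := real_inner_le_norm (p - q) (p' - q')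
  by_contra! hlt
  nlinarith [norm_nonneg (p - q), norm_nonneg (p' - q')]

/-! ### Projections onto closed convex sets. -/

section Projection

variable {k : ℕ} {C : Set (Euc k)}

theorem proj_spec (hne : C.Nonempty) (hcl : IsClosed C) (hco : Convex ℝ C) (p : Euc k) :
    proj C p ∈ C ∧ ∀ y ∈ C, inner ℝ (p - proj C p) (y - proj C p) ≤ 0 := by
  have hex : ∃ q, q ∈ C ∧ ∀ y ∈ C, ‖q - p‖ ≤ ‖y - p‖ := by
    obtain ⟨q, hq, hmin⟩ := hcl.exists_infDist_eq_dist hne p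
    refine ⟨q, hq, fun y hy => ?_⟩
    rw [← dist_eq_norm, ← dist_eq_norm, dist_comm q, dist_comm y, ← hmin]
    exact Metric.infDist_le_dist_of_mem hy
  have hp : proj C p ∈ C ∧ ∀ y ∈ C, ‖proj C p - p‖ ≤ ‖y - p‖ := Classical.epsilon_spec hex
  refine ⟨hp.1, (norm_eq_iInf_iff_real_inner_le_zero hco hp.1).1 ?_⟩
  have : Nonempty C := hne.to_subtype
  refine le_antisymm (le_ciInf fun y => ?_)
    (ciInf_le ⟨0, by rintro _ ⟨y, rfl⟩; exact norm_nonneg _⟩ (⟨_, hp.1⟩ : C))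
  rw [norm_sub_rev p, norm_sub_rev p]
  exact hp.2 y y.2

theorem proj_lipschitz (hne : C.Nonempty) (hcl : IsClosed C) (hco : Convex ℝ C) (p q : Euc k) :
    ‖proj C p - proj C q‖ ≤ ‖p - q‖ := by
  obtain ⟨hp, hp'⟩ := proj_spec hne hcl hco p
  obtain ⟨hq, hq'⟩ := proj_spec hne hcl hco q
  exact norm_sub_le_of_obtuse (hp' _ hq) (hq' _ hp)

theorem continuous_proj (hne : C.Nonempty) (hcl : IsClosed C) (hco : Convex ℝ C) :
    Continuous (proj C) :=
  LipschitzWith.continuous (K := 1) <| LipschitzWith.of_dist_le_mul fun p q => by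
    simpa [dist_eq_norm] using proj_lipschitz hne hcl hco p q

theorem orthant_nonempty (m : ℕ) : (orthant m).Nonempty := ⟨0, fun _ => le_rfl⟩

theorem isClosed_orthant (m : ℕ) : IsClosed (orthant m) := by
  have : orthant m = ⋂ r, {v : Euc m | 0 ≤ v r} := by ext; simp [orthant]
  rw [this]
  exact isClosed_iInter fun r => isClosed_le continuous_const (by fun_prop)

theorem convex_orthant (m : ℕ) : Convex ℝ (orthant m) := by
  intro x hx y hy a b ha hb _ r
  have h1 := mul_nonneg ha (hx r)
  have h2 := mul_nonneg hb (hy r)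
  simpa using add_nonneg h1 h2

end Projection

/-! ### Positive definiteness, and lower bounds from the norm of the inverse. -/

section Matrices

/-- By Gershgorin each eigenvalue is within the off-diagonal row sum of some diagonal entry, hence
positive. -/
theorem posDef_of_sum_row_lt_diag {ι : Type*} [Fintype ι] [DecidableEq ι] {M : Matrix ι ι ℝ}
    (hM : M.IsHermitian) (h : ∀ k, ∑ j ∈ Finset.univ.erase k, |M k j| < M k k) : M.PosDef := by
  rw [hM.posDef_iff_eigenvalues_pos]
  intro i
  have hev : Module.End.HasEigenvalue (Matrix.toLin' M) (hM.eigenvalues i) := by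
    refine Module.End.hasEigenvalue_of_hasEigenvector
      (x := WithLp.ofLp (hM.eigenvectorBasis i)) ⟨?_, ?_⟩
    · rw [Module.End.mem_eigenspace_iff, Matrix.toLin'_apply, hM.mulVec_eigenvectorBasis]
    · intro h0
      have := hM.eigenvectorBasis.orthonormal.ne_zero i
      exact this (by ext j; simpa using congrFun h0 j)
  obtain ⟨k, hk⟩ := eigenvalue_mem_ball hev
  rw [Metric.mem_closedBall, Real.dist_eq] at hk
  simp only [Real.norm_eq_abs] at hk
  have := h k
  have := (abs_le.1 hk).1
  linarith

/-- This turns the step-size bound on `‖Ψ⁻¹‖` into strong positivity of `Ψ`. -/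
theorem inv_mul_dotProduct_le {ι : Type*} [Fintype ι] [DecidableEq ι] {M : Matrix ι ι ℝ}
    (hM : M.PosDef) {κ : ℝ} (hκ : 0 < κ) (hn : ‖Matrix.toEuclideanCLM (𝕜 := ℝ) M⁻¹‖ ≤ κ)
    (v : ι → ℝ) : κ⁻¹ * (v ⬝ᵥ v) ≤ v ⬝ᵥ (M *ᵥ v) := by
  set y : ι → ℝ := M⁻¹ *ᵥ v with hy
  have hdet : IsUnit M.det := hM.isUnit.map Matrix.detMonoidHom
  have hMy : M *ᵥ y = v := by
    rw [hy, Matrix.mulVec_mulVec, Matrix.mul_nonsing_inv _ hdet, Matrix.one_mulVec]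
  have hsymm : Mᵀ = M := by simpa using hM.isHermitian.eq
  have hyv : y ⬝ᵥ (M *ᵥ v) = v ⬝ᵥ v := by
    rw [Matrix.dotProduct_mulVec, ← Matrix.mulVec_transpose, hsymm, hMy]
  have hvy : v ⬝ᵥ y ≤ κ * (v ⬝ᵥ v) := by
    have h1 : v ⬝ᵥ y = inner ℝ (WithLp.toLp 2 v : EuclideanSpace ℝ ι)
        (Matrix.toEuclideanCLM (𝕜 := ℝ) M⁻¹ (WithLp.toLp 2 v)) := by
      rw [Matrix.inner_toEuclideanCLM]
    have h2 : v ⬝ᵥ v = ‖(WithLp.toLp 2 v : EuclideanSpace ℝ ι)‖ ^ 2 := by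
      rw [EuclideanSpace.real_norm_sq_eq]
      simp [dotProduct, sq]
    rw [h1, h2]
    refine (real_inner_le_norm _ _).trans ?_
    have h3 := (Matrix.toEuclideanCLM (𝕜 := ℝ) M⁻¹).le_opNorm (WithLp.toLp 2 v)
    have h4 := mul_le_mul_of_nonneg_right hn (norm_nonneg (WithLp.toLp 2 v : EuclideanSpace ℝ ι))
    have h5 := mul_le_mul_of_nonneg_left (h3.trans h4)
      (norm_nonneg (WithLp.toLp 2 v : EuclideanSpace ℝ ι))
    linarith
  -- With `y = M⁻¹ v`, expanding the form at `v - κ⁻¹ y` gives `v·Mv - 2κ⁻¹ v·v + κ⁻² y·v ≥ 0`, and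
  -- `y·v ≤ κ v·v` absorbs one of the two copies of `κ⁻¹ v·v`.
  have hpos := hM.posSemidef.dotProduct_mulVec_nonneg (v - κ⁻¹ • y)
  simp only [star_trivial, Matrix.mulVec_sub, Matrix.mulVec_smul, hMy, sub_dotProduct,
    dotProduct_sub, smul_dotProduct, dotProduct_smul, hyv, smul_eq_mul] at hpos
  have h6 : κ⁻¹ * (κ⁻¹ * (y ⬝ᵥ v)) ≤ κ⁻¹ * (v ⬝ᵥ v) := by
    refine mul_le_mul_of_nonneg_left ?_ (inv_nonneg.2 hκ.le)
    rw [dotProduct_comm y, inv_mul_le_iff₀ hκ]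
    exact hvy
  linarith

end Matrices

section MulE

variable {p q : ℕ} (M : Matrix (Fin p) (Fin q) ℝ)

theorem mulE_add (v w : Euc q) : mulE M (v + w) = mulE M v + mulE M w := by
  simp [mulE, Matrix.mulVec_add]

theorem mulE_sub (v w : Euc q) : mulE M (v - w) = mulE M v - mulE M w := by
  simp [mulE, Matrix.mulVec_sub]

theorem mulE_smul (t : ℝ) (v : Euc q) : mulE M (t • v) = t • mulE M v := by
  simp [mulE, Matrix.mulVec_smul]

theorem inner_mulE_left (v : Euc q) (w : Euc p) :
    inner ℝ (mulE M v) w = inner ℝ v (mulE Mᵀ w) := by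
  simp only [mulE, EuclideanSpace.inner_eq_star_dotProduct, star_trivial]
  rw [Matrix.dotProduct_mulVec, ← Matrix.mulVec_transpose, dotProduct_comm,
    Matrix.mulVec_transpose, dotProduct_comm, ← Matrix.mulVec_transpose]

theorem continuous_mulE : Continuous (mulE M) := by
  unfold mulE
  fun_prop

end MulE

/-- Stacked dual variables with the Euclidean structure of `ℝ^(N m)`. -/
abbrev Stack (N m : ℕ) : Type := PiLp 2 (fun _ : Fin N => Euc m)

theorem inner_profile {N : ℕ} {q : Fin N → ℕ} (x y : Profile q) :
    inner ℝ x y = ∑ i, inner ℝ (x i) (y i) := PiLp.inner_apply x y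

theorem inner_stack {N m : ℕ} (x y : Stack N m) :
    inner ℝ x y = ∑ i, inner ℝ (x i) (y i) := PiLp.inner_apply x y

/-! ### The graph Laplacian on stacked vectors. -/

section Laplacian

variable {N m : ℕ} {𝒢 : SimpleGraph (Fin N)} {W : Matrix (Fin N) (Fin N) ℝ}

theorem GraphAssumption.nonneg (hW : GraphAssumption 𝒢 W) (i j : Fin N) : 0 ≤ W i j := by
  by_cases h : 𝒢.Adj i j
  · exact (hW.pos i j h).le
  · exact (hW.zero i j h).ge

/-- The Laplacian `L ⊗ I_m` acting on stacked vectors. -/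
def lap (W : Matrix (Fin N) (Fin N) ℝ) : Stack N m →ₗ[ℝ] Stack N m where
  toFun v := WithLp.toLp 2 fun i => ∑ j, W i j • (v i - v j)
  map_add' v w := by
    ext1 i
    simp only [PiLp.add_apply, ← Finset.sum_add_distrib, ← smul_add]
    refine Finset.sum_congr rfl fun j _ => ?_
    congr 1
    abel
  map_smul' t v := by
    ext1 i
    simp only [PiLp.smul_apply, RingHom.id_apply, Finset.smul_sum]
    refine Finset.sum_congr rfl fun j _ => ?_
    rw [← smul_sub, smul_comm]

theorem lap_apply (v : Stack N m) (i : Fin N) : lap W v i = ∑ j, W i j • (v i - v j) := rfl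

/-- The Dirichlet form: symmetrizing the double sum over ordered pairs counts each edge twice, hence
the factor `2`. Symmetry, cocoercivity and the description of the kernel all follow from it. -/
theorem inner_lap (hs : W.IsSymm) (v w : Stack N m) :
    2 * inner ℝ (lap W v) w = ∑ i, ∑ j, W i j * inner ℝ (v i - v j) (w i - w j) := by
  have h1 : inner ℝ (lap W v) w = ∑ i, ∑ j, W i j * inner ℝ (v i - v j) (w i) := by
    simp only [inner_stack, lap_apply, sum_inner, real_inner_smul_left]
  have h2 : ∑ i, ∑ j, W i j * inner ℝ (v i - v j) (w j) = - inner ℝ (lap W v) w := by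
    rw [h1, Finset.sum_comm, ← Finset.sum_neg_distrib]
    refine Finset.sum_congr rfl fun i _ => ?_
    rw [← Finset.sum_neg_distrib]
    refine Finset.sum_congr rfl fun j _ => ?_
    rw [hs.apply, ← neg_sub (v i), inner_neg_left]
    ring
  simp only [inner_sub_right, mul_sub, Finset.sum_sub_distrib]
  simp only [h2, ← h1]
  ring

theorem isSymmetric_lap (hs : W.IsSymm) : (lap W : Stack N m →ₗ[ℝ] Stack N m).IsSymmetric := by
  intro v w
  have h1 := inner_lap hs v w
  have h2 := inner_lap hs w v
  rw [real_inner_comm] at h2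
  have : ∑ i, ∑ j, W i j * inner ℝ (v i - v j) (w i - w j)
      = ∑ i, ∑ j, W i j * inner ℝ (w i - w j) (v i - v j) := by
    simp only [real_inner_comm]
  linarith

theorem norm_sum_smul_sq_le {ι E : Type*} [Fintype ι] [NormedAddCommGroup E]
    [NormedSpace ℝ E] {w : ι → ℝ} (hw : ∀ i, 0 ≤ w i) (v : ι → E) :
    ‖∑ i, w i • v i‖ ^ 2 ≤ (∑ i, w i) * ∑ i, w i * ‖v i‖ ^ 2 := by
  have h1 : ‖∑ i, w i • v i‖ ≤ ∑ i, w i * ‖v i‖ := by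
    refine (norm_sum_le _ _).trans (Finset.sum_le_sum fun i _ => ?_)
    rw [norm_smul, Real.norm_of_nonneg (hw i)]
  refine (pow_le_pow_left₀ (norm_nonneg _) h1 2).trans ?_
  refine Finset.sum_sq_le_sum_mul_sum_of_sq_le_mul _ (fun i _ => hw i)
    (fun i _ => mul_nonneg (hw i) (sq_nonneg _)) fun i _ => le_of_eq ?_
  ring

/-- Weighted Cauchy-Schwarz bounds `‖(Lv)_i‖²` by `d_i` times the local Dirichlet energy. Since `θ
d_i ≤ 1/2`, summing over `i` gives at most half the double sum of `inner_lap`, which is `⟪Lv, v⟫`.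
-/
theorem GraphAssumption.lap_cocoercive (hW : GraphAssumption 𝒢 W) {θ : ℝ} (hθ : 0 < θ)
    (hd : ∀ i, 2 * degree W i * θ ≤ 1) (v : Stack N m) :
    θ * ‖lap W v‖ ^ 2 ≤ inner ℝ (lap W v) v := by
  have h1 := inner_lap hW.symm v v
  simp only [real_inner_self_eq_norm_sq] at h1
  have h2 : θ * ‖lap W v‖ ^ 2 ≤ ∑ i, (1 / 2) * ∑ j, W i j * ‖v i - v j‖ ^ 2 := by
    rw [PiLp.norm_sq_eq_of_L2, Finset.mul_sum]
    refine Finset.sum_le_sum fun i _ => ?_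
    have h3 : ‖lap W v i‖ ^ 2 ≤ degree W i * ∑ j, W i j * ‖v i - v j‖ ^ 2 :=
      norm_sum_smul_sq_le (hW.nonneg i) _
    have h4 : 0 ≤ ∑ j, W i j * ‖v i - v j‖ ^ 2 :=
      Finset.sum_nonneg fun j _ => mul_nonneg (hW.nonneg i j) (sq_nonneg _)
    nlinarith [hd i, mul_le_mul_of_nonneg_right (hd i) h4, mul_le_mul_of_nonneg_left h3 hθ.le]
  rw [← Finset.mul_sum] at h2
  linarith

/-- Every term of the Dirichlet form vanishes, so `v` agrees across each edge, and connectedness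
propagates this along walks. -/
theorem GraphAssumption.eq_of_lap_eq_zero (hW : GraphAssumption 𝒢 W) {v : Stack N m}
    (hv : lap W v = 0) (i j : Fin N) : v i = v j := by
  have h1 := inner_lap hW.symm v v
  rw [hv, inner_zero_left, mul_zero] at h1
  simp only [real_inner_self_eq_norm_sq] at h1
  have hnn : ∀ i j, 0 ≤ W i j * ‖v i - v j‖ ^ 2 := fun i j =>
    mul_nonneg (hW.nonneg i j) (sq_nonneg _)
  have h2 : ∀ i j, W i j * ‖v i - v j‖ ^ 2 = 0 := fun i j => by
    have h3 := (Finset.sum_eq_zero_iff_of_nonneg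
      fun i _ => Finset.sum_nonneg fun j _ => hnn i j).1 h1.symm i (Finset.mem_univ i)
    exact (Finset.sum_eq_zero_iff_of_nonneg fun j _ => hnn i j).1 h3 j (Finset.mem_univ j)
  have hadj : ∀ i j, 𝒢.Adj i j → v i = v j := fun i j h => by
    have := (mul_eq_zero.1 (h2 i j)).resolve_left (hW.pos i j h).ne'
    simpa [sub_eq_zero] using this
  obtain ⟨p⟩ := hW.connected.preconnected i j
  induction p with
  | nil => rfl
  | cons h _ ih => exact (hadj _ _ h).trans ih

theorem lap_const (c : Euc m) : lap W (WithLp.toLp 2 fun _ => c : Stack N m) = 0 := by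
  ext1 i
  simp [lap_apply]

/-- The range of a symmetric operator is the orthogonal complement of its kernel, here the constant
stacks, and orthogonality to these is exactly the zero-sum condition. -/
theorem GraphAssumption.exists_lap_eq (hW : GraphAssumption 𝒢 W) {v : Stack N m}
    (hv : ∑ i, v i = 0) : ∃ z : Stack N m, lap W z = v := by
  have h1 : v ∈ (LinearMap.range (lap W : Stack N m →ₗ[ℝ] Stack N m))ᗮᗮ := by
    rw [(isSymmetric_lap hW.symm).orthogonal_range, Submodule.mem_orthogonal]
    intro u hu
    obtain ⟨i₀⟩ := hW.connected.nonempty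
    have h2 : ∀ i, u i = u i₀ := fun i => hW.eq_of_lap_eq_zero hu i i₀
    rw [inner_stack]
    simp only [h2, ← inner_sum, hv, inner_zero_right]
  rw [Submodule.orthogonal_orthogonal] at h1
  exact h1

end Laplacian

/-! ### The space of triples and the linear parts of the iteration. -/

section Extended

/-- The space of the triples `(x, z, λ)`. -/
abbrev Ext {N : ℕ} (n : Fin N → ℕ) (m : ℕ) : Type :=
  WithLp 2 (Profile n × WithLp 2 (Stack N m × Stack N m))

variable {N m : ℕ} {n : Fin N → ℕ}

/-- The triple `(x, z, λ)`. -/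
def triple (x : Profile n) (z l : Stack N m) : Ext n m :=
  WithLp.toLp 2 (x, WithLp.toLp 2 (z, l))

@[simp] theorem triple_fst (x : Profile n) (z l : Stack N m) : (triple x z l).fst = x := rfl
@[simp] theorem triple_snd_fst (x : Profile n) (z l : Stack N m) :
    (triple x z l).snd.fst = z := rfl
@[simp] theorem triple_snd_snd (x : Profile n) (z l : Stack N m) :
    (triple x z l).snd.snd = l := rfl

theorem inner_ext (u v : Ext n m) : inner ℝ u v =
    inner ℝ u.fst v.fst + (inner ℝ u.snd.fst v.snd.fst + inner ℝ u.snd.snd v.snd.snd) := rfl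

theorem norm_ext_sq (u : Ext n m) :
    ‖u‖ ^ 2 = ‖u.fst‖ ^ 2 + (‖u.snd.fst‖ ^ 2 + ‖u.snd.snd‖ ^ 2) := by
  simp only [← real_inner_self_eq_norm_sq, inner_ext]

theorem ext_of_components {u v : Ext n m} (h1 : u.fst = v.fst) (h2 : u.snd.fst = v.snd.fst)
    (h3 : u.snd.snd = v.snd.snd) : u = v := by
  have : u - v = 0 := by
    rw [← norm_eq_zero, ← sq_eq_zero_iff, norm_ext_sq]
    simp [h1, h2, h3]
  exact sub_eq_zero.1 this

/-- The block diagonal operator `x ↦ col(A_1 x_1, …, A_N x_N)`. -/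
def blockMap (A : (i : Fin N) → Matrix (Fin m) (Fin (n i)) ℝ) : Profile n →ₗ[ℝ] Stack N m where
  toFun x := WithLp.toLp 2 fun i => mulE (A i) (x i)
  map_add' x y := by ext1 i; simp [mulE_add]
  map_smul' t x := by ext1 i; simp [mulE_smul]

/-- The adjoint of `blockMap`. -/
def blockMapT (A : (i : Fin N) → Matrix (Fin m) (Fin (n i)) ℝ) : Stack N m →ₗ[ℝ] Profile n where
  toFun l := WithLp.toLp 2 fun i => mulE (A i)ᵀ (l i)
  map_add' x y := by ext1 i; simp [mulE_add]
  map_smul' t x := by ext1 i; simp [mulE_smul]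

/-- Multiplication of the `i`-th block by `t i`. -/
def scale {q : Fin N → ℕ} (t : Fin N → ℝ) : Profile q →ₗ[ℝ] Profile q where
  toFun x := WithLp.toLp 2 fun i => t i • x i
  map_add' x y := by ext1 i; simp
  map_smul' s x := by ext1 i; simp [smul_comm s]

variable (A : (i : Fin N) → Matrix (Fin m) (Fin (n i)) ℝ) (W : Matrix (Fin N) (Fin N) ℝ)

theorem blockMap_apply (x : Profile n) (i : Fin N) : blockMap A x i = mulE (A i) (x i) := rfl
theorem blockMapT_apply (l : Stack N m) (i : Fin N) : blockMapT A l i = mulE (A i)ᵀ (l i) := rfl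
theorem scale_apply {q : Fin N → ℕ} (t : Fin N → ℝ) (x : Profile q) (i : Fin N) :
    scale t x i = t i • x i := rfl

theorem inner_blockMap (x : Profile n) (l : Stack N m) :
    inner ℝ (blockMap A x) l = inner ℝ x (blockMapT A l) := by
  simp only [inner_stack, inner_profile, blockMap_apply, blockMapT_apply, inner_mulE_left]

theorem inner_scale {q : Fin N → ℕ} (t : Fin N → ℝ) (x y : Profile q) :
    inner ℝ (scale t x) y = inner ℝ x (scale t y) := by
  simp only [inner_profile, scale_apply, real_inner_smul_left, real_inner_smul_right]

/-- The linear skew-symmetric part of the KKT operator. -/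
def skewMap : Ext n m →ₗ[ℝ] Ext n m where
  toFun u := triple (blockMapT A u.snd.snd) (lap W u.snd.snd)
    (-(blockMap A u.fst) - lap W u.snd.fst)
  map_add' u v := by
    apply ext_of_components
    · simp
    · simp
    · simp
      abel
  map_smul' t u := by
    apply ext_of_components <;> simp [smul_sub]

/-- The preconditioner `Ψ` as an operator. -/
def precondMap (γ : StepSizes N) : Ext n m →ₗ[ℝ] Ext n m where
  toFun u := triple (scale (fun i => (γ.α i)⁻¹) u.fst - blockMapT A u.snd.snd)
    (scale (fun i => (γ.ν i)⁻¹) u.snd.fst - lap W u.snd.snd)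
    (scale (fun i => (γ.σ i)⁻¹) u.snd.snd - blockMap A u.fst - lap W u.snd.fst)
  map_add' u v := by
    apply ext_of_components <;> simp <;> abel
  map_smul' t u := by
    apply ext_of_components <;> simp [smul_sub]

theorem skewMap_apply (u : Ext n m) : skewMap A W u = triple (blockMapT A u.snd.snd)
    (lap W u.snd.snd) (-(blockMap A u.fst) - lap W u.snd.fst) := rfl

theorem precondMap_apply (γ : StepSizes N) (u : Ext n m) : precondMap A W γ u =
    triple (scale (fun i => (γ.α i)⁻¹) u.fst - blockMapT A u.snd.snd)
      (scale (fun i => (γ.ν i)⁻¹) u.snd.fst - lap W u.snd.snd)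
      (scale (fun i => (γ.σ i)⁻¹) u.snd.snd - blockMap A u.fst - lap W u.snd.fst) := rfl

variable {A W}

theorem inner_skewMap_self (hs : W.IsSymm) (u : Ext n m) : inner ℝ (skewMap A W u) u = 0 := by
  have h1 := inner_blockMap A u.fst u.snd.snd
  have h2 := isSymmetric_lap (m := m) hs u.snd.fst u.snd.snd
  rw [real_inner_comm] at h1
  simp only [inner_ext, skewMap_apply, triple_fst, triple_snd_fst, triple_snd_snd, inner_sub_left,
    inner_neg_left, h2]
  rw [real_inner_comm u.fst, real_inner_comm u.snd.fst, ← h1, real_inner_comm u.snd.snd]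
  ring

theorem isSymmetric_precondMap (hs : W.IsSymm) (γ : StepSizes N) :
    (precondMap A W γ : Ext n m →ₗ[ℝ] Ext n m).IsSymmetric := by
  intro u v
  simp only [inner_ext, precondMap_apply, triple_fst, triple_snd_fst, triple_snd_snd,
    inner_sub_left, inner_sub_right, inner_scale, inner_blockMap]
  have h1 := isSymmetric_lap (m := m) hs u.snd.fst v.snd.snd
  have h2 := isSymmetric_lap (m := m) hs u.snd.snd v.snd.fst
  have h3 := inner_blockMap A v.fst u.snd.snd
  have h4 := real_inner_comm (blockMapT A u.snd.snd) v.fst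
  have h5 := real_inner_comm (blockMap A v.fst) u.snd.snd
  linarith

end Extended

/-! ### Diagonal dominance and strong positivity of `Ψ`. -/

section Preconditioner

variable {N m : ℕ} {n : Fin N → ℕ} {A : (i : Fin N) → Matrix (Fin m) (Fin (n i)) ℝ}
  {W : Matrix (Fin N) (Fin N) ℝ} {𝒢 : SimpleGraph (Fin N)} {γ : StepSizes N}

theorem isSymm_laplacian (hs : W.IsSymm) : (laplacian W).IsSymm := by
  unfold laplacian Matrix.IsSymm
  rw [Matrix.transpose_sub, Matrix.diagonal_transpose, hs.eq]

theorem isHermitian_precond (hs : W.IsSymm) : (precond A W γ).IsHermitian := by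
  have hL : ((laplacian W) ⊗ₖ (1 : Matrix (Fin m) (Fin m) ℝ))ᵀ
      = (laplacian W) ⊗ₖ (1 : Matrix (Fin m) (Fin m) ℝ) := by
    rw [← Matrix.kroneckerMap_transpose, (isSymm_laplacian hs).eq, Matrix.transpose_one]
  unfold precond Matrix.IsHermitian
  simp only [Matrix.conjTranspose_eq_transpose_of_trivial, Matrix.fromBlocks_transpose,
    Matrix.diagonal_transpose, Matrix.transpose_fromCols, Matrix.transpose_fromRows,
    Matrix.transpose_neg, Matrix.transpose_transpose, hL, Matrix.transpose_zero]

theorem GraphAssumption.sum_abs_laplacian (hW : GraphAssumption 𝒢 W) (i : Fin N) :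
    ∑ j, |laplacian W i j| ≤ 2 * degree W i := by
  have hd : 0 ≤ degree W i := Finset.sum_nonneg fun j _ => hW.nonneg i j
  have h1 : ∀ j, |laplacian W i j| ≤ Matrix.diagonal (degree W) i j + W i j := fun j => by
    have h2 : 0 ≤ Matrix.diagonal (degree W) i j := by
      rw [Matrix.diagonal_apply]; split_ifs <;> simp [hd]
    rw [laplacian, Matrix.sub_apply]
    refine (abs_sub _ _).trans ?_
    rw [abs_of_nonneg h2, abs_of_nonneg (hW.nonneg i j)]
  refine (Finset.sum_le_sum fun j _ => h1 j).trans ?_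
  rw [Finset.sum_add_distrib]
  simp only [Matrix.diagonal_apply, Finset.sum_ite_eq, Finset.mem_univ, if_true]
  rw [degree]
  linarith

theorem sum_abs_kronecker_one (L : Matrix (Fin N) (Fin N) ℝ) (p : Fin N × Fin m) :
    ∑ q, |(L ⊗ₖ (1 : Matrix (Fin m) (Fin m) ℝ)) p q| = ∑ j, |L p.1 j| := by
  rw [Fintype.sum_prod_type]
  refine Finset.sum_congr rfl fun j _ => ?_
  rw [Finset.sum_eq_single p.2]
  · simp
  · intro r _ hr
    simp [hr.symm]
  · simp

theorem sum_abs_blockA_row (p : Fin N × Fin m) :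
    ∑ q, |blockA A p q| = ∑ k, |A p.1 p.2 k| := by
  rw [Fintype.sum_sigma, Finset.sum_eq_single p.1]
  · simp [blockA]
  · intro i _ hi
    simp [blockA, hi.symm]
  · simp

theorem sum_abs_blockA_col (q : (i : Fin N) × Fin (n i)) :
    ∑ p, |blockA A p q| = ∑ k, |A q.1 k q.2| := by
  rw [Fintype.sum_prod_type, Finset.sum_eq_single q.1]
  · simp [blockA]
  · intro i _ hi
    simp [blockA, hi]
  · simp

theorem sum_abs_diagonal {ι : Type*} [Fintype ι] [DecidableEq ι] (v : ι → ℝ) (k : ι) :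
    ∑ j, |Matrix.diagonal v k j| = |v k| := by
  rw [Finset.sum_eq_single k]
  · simp
  · intro j _ hj
    simp [hj.symm]
  · simp

theorem posDef_precond (hW : GraphAssumption 𝒢 W) {β θ τ : ℝ}
    (hγ : StepAssumption A W β θ τ γ) : (precond A W γ).PosDef := by
  refine posDef_of_sum_row_lt_diag (isHermitian_precond hW.symm) fun k => ?_
  have hd : ∀ i, 0 ≤ degree W i := fun i => Finset.sum_nonneg fun j _ => hW.nonneg i j
  have hτ := hγ.τ_pos
  -- The margin `τ > 0` is what makes the dominance strict.
  have hle : ∀ {s t : ℝ}, 0 < s → 0 ≤ t → s ≤ (t + τ)⁻¹ → t < s⁻¹ := fun {s t} hs ht h => by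
    have := (le_inv_comm₀ hs (by positivity)).1 h
    linarith
  rw [Finset.sum_erase_eq_sub (Finset.mem_univ k)]
  -- Adding the diagonal entry to both sides allows sums over full rows, which split along the
  -- blocks.
  suffices h : ∑ j, |precond A W γ k j| < 2 * precond A W γ k k by
    have := le_abs_self (precond A W γ k k)
    linarith
  rcases k with q | p | p
  · have h1 := hle (hγ.α_pos q.1) (Finset.sum_nonneg fun _ _ => abs_nonneg _) (hγ.α_le q.1 q.2)
    have h2 := inv_pos.2 (hγ.α_pos q.1)
    simp only [precond, Fintype.sum_sum_type, Matrix.fromBlocks_apply₁₁, Matrix.fromBlocks_apply₁₂,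
      Matrix.fromCols_apply_inl, Matrix.fromCols_apply_inr, Matrix.neg_apply, abs_neg,
      Matrix.transpose_apply, Matrix.zero_apply, abs_zero, Finset.sum_const_zero,
      sum_abs_blockA_col, sum_abs_diagonal, Matrix.diagonal_apply_eq, abs_of_pos h2]
    simp only [Matrix.transpose_apply] at h1
    linarith
  · have h1 := hle (hγ.ν_pos p.1) (by linarith [hd p.1]) (hγ.ν_le p.1)
    have h2 := inv_pos.2 (hγ.ν_pos p.1)
    have h3 := hW.sum_abs_laplacian p.1
    simp only [precond, Fintype.sum_sum_type, Matrix.fromBlocks_apply₂₁, Matrix.fromBlocks_apply₂₂,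
      Matrix.fromBlocks_apply₁₁, Matrix.fromBlocks_apply₁₂,
      Matrix.fromRows_apply_inl, Matrix.neg_apply, abs_neg, sum_abs_kronecker_one,
      Matrix.zero_apply, abs_zero, Finset.sum_const_zero,
      sum_abs_diagonal, Matrix.diagonal_apply_eq, abs_of_pos h2]
    linarith
  · have h0 : 0 ≤ ∑ k, |A p.1 p.2 k| := Finset.sum_nonneg fun _ _ => abs_nonneg _
    have h1 := hle (hγ.σ_pos p.1) (by linarith [hd p.1]) (hγ.σ_le p.1 p.2)
    have h2 := inv_pos.2 (hγ.σ_pos p.1)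
    have h3 := hW.sum_abs_laplacian p.1
    simp only [precond, Fintype.sum_sum_type, Matrix.fromBlocks_apply₂₁, Matrix.fromBlocks_apply₂₂,
      Matrix.fromRows_apply_inr, Matrix.neg_apply, abs_neg, sum_abs_kronecker_one,
      sum_abs_blockA_row, sum_abs_diagonal, Matrix.diagonal_apply_eq, abs_of_pos h2]
    linarith

/-- The coordinates of a triple. -/
def coords (u : Ext n m) : ((i : Fin N) × Fin (n i)) ⊕ ((Fin N × Fin m) ⊕ (Fin N × Fin m)) → ℝ :=
  Sum.elim (fun q => u.fst q.1 q.2)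
    (Sum.elim (fun p => u.snd.fst p.1 p.2) (fun p => u.snd.snd p.1 p.2))

theorem inner_ext_eq_dotProduct (u v : Ext n m) : inner ℝ u v = coords u ⬝ᵥ coords v := by
  have h : ∀ {k : ℕ} (x y : Euc k), inner ℝ x y = ∑ i, x i * y i := fun x y => by
    simp [PiLp.inner_apply, mul_comm]
  simp only [inner_ext, inner_profile, h, coords, dotProduct, Fintype.sum_sum_type,
    Fintype.sum_sigma, Fintype.sum_prod_type, Sum.elim_inl, Sum.elim_inr]

theorem kronecker_one_mulVec (l : Stack N m) (p : Fin N × Fin m) :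
    ((laplacian W ⊗ₖ (1 : Matrix (Fin m) (Fin m) ℝ)) *ᵥ fun q => l q.1 q.2) p
      = lap W l p.1 p.2 := by
  simp only [Matrix.mulVec, dotProduct, Fintype.sum_prod_type, Matrix.kroneckerMap_apply,
    Matrix.one_apply, mul_ite, mul_one, mul_zero, ite_mul, zero_mul, Finset.sum_ite_eq,
    Finset.mem_univ, if_true, laplacian, Matrix.sub_apply, sub_mul, Finset.sum_sub_distrib,
    Matrix.diagonal_apply, lap_apply]
  simp [mul_sub, Finset.sum_sub_distrib, degree, Finset.sum_mul]

/-- This links the operator used in the convergence argument to the matrix in the step-size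
condition. -/
theorem coords_precondMap (u : Ext n m) :
    coords (precondMap A W γ u) = precond A W γ *ᵥ coords u := by
  have hA : ∀ p : Fin N × Fin m, (blockA A *ᵥ fun q => u.fst q.1 q.2) p
      = blockMap A u.fst p.1 p.2 := fun p => by
    simp only [Matrix.mulVec, dotProduct, Fintype.sum_sigma, blockA, Matrix.of_apply,
      blockMap_apply, mulE]
    rw [Finset.sum_eq_single p.1]
    · simp
    · intro i _ hi
      simp [hi.symm]
    · simp
  have hAt : ∀ q : (i : Fin N) × Fin (n i), ((blockA A)ᵀ *ᵥ fun p => u.snd.snd p.1 p.2) q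
      = blockMapT A u.snd.snd q.1 q.2 := fun q => by
    simp only [Matrix.mulVec, dotProduct, Fintype.sum_prod_type, blockA, Matrix.of_apply,
      blockMapT_apply, mulE, Matrix.transpose_apply]
    rw [Finset.sum_eq_single q.1]
    · simp
    · intro i _ hi
      simp [hi]
    · simp
  funext k
  unfold precond coords
  rw [Matrix.fromBlocks_mulVec, Matrix.fromBlocks_mulVec]
  rcases k with q | p | p
  · simp [precondMap_apply, Matrix.fromCols_mulVec, Matrix.mulVec_diagonal, Matrix.neg_mulVec,
      hAt, Function.comp_def, scale_apply, sub_eq_add_neg]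
  · simp [precondMap_apply, Matrix.fromRows_mulVec, Matrix.mulVec_diagonal, Matrix.neg_mulVec,
      kronecker_one_mulVec, Function.comp_def, scale_apply, sub_eq_add_neg]
  · simp [precondMap_apply, Matrix.fromRows_mulVec, Matrix.mulVec_diagonal, Matrix.neg_mulVec,
      kronecker_one_mulVec, hA, Function.comp_def, scale_apply, sub_eq_add_neg]
    ring

theorem le_inner_precondMap (hW : GraphAssumption 𝒢 W) {β θ τ : ℝ}
    (hγ : StepAssumption A W β θ τ γ) (u : Ext n m) :
    8 / θ * ‖u‖ ^ 2 ≤ inner ℝ (precondMap A W γ u) u := by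
  have h1 := inv_mul_dotProduct_le (posDef_precond hW hγ) (div_pos hγ.θ_pos (by norm_num : (0:ℝ) < 8))
    hγ.norm_inv_lt.le (coords u)
  rw [inv_div, ← coords_precondMap, ← inner_ext_eq_dotProduct, ← inner_ext_eq_dotProduct,
    real_inner_self_eq_norm_sq, real_inner_comm] at h1
  exact h1

end Preconditioner

/-- Subtracting the partial sums of `g` from `V` gives a decreasing sequence that is bounded below.
Only convergence of these partial sums is needed, not absolute summability, so `g` may contain
martingale increments. -/
theorem tendsto_and_summable_of_quasi_descent {V a g : ℕ → ℝ} (hV : ∀ k, 0 ≤ V k)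
    (ha : ∀ k, 0 ≤ a k) (h : ∀ k, V (k + 1) ≤ V k - a k + g k) {l : ℝ}
    (hg : Tendsto (fun j => ∑ k ∈ Finset.range j, g k) atTop (𝓝 l)) :
    (∃ v, Tendsto V atTop (𝓝 v)) ∧ Summable a := by
  obtain ⟨R, hR⟩ := hg.bddAbove_range
  have hR' : ∀ j, ∑ k ∈ Finset.range j, g k ≤ R := fun j => hR ⟨j, rfl⟩
  have hanti : Antitone fun j => V j - ∑ k ∈ Finset.range j, g k :=
    antitone_nat_of_succ_le fun j => by
      rw [Finset.sum_range_succ]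
      linarith [h j, ha j]
  have hbdd : BddBelow (Set.range fun j => V j - ∑ k ∈ Finset.range j, g k) :=
    ⟨-R, by rintro _ ⟨j, rfl⟩; linarith [hV j, hR' j]⟩
  refine ⟨⟨_, by simpa using (tendsto_atTop_ciInf hanti hbdd).add hg⟩,
    summable_of_sum_range_le (c := V 0 + R) ha fun j => ?_⟩
  have hsum : ∑ k ∈ Finset.range j, a k ≤ V 0 - V j + ∑ k ∈ Finset.range j, g k := by
    induction j with
    | zero => simp
    | succ j ih =>
      rw [Finset.sum_range_succ, Finset.sum_range_succ]
      linarith [h j]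
  linarith [hV j, hR' j]

/-! ### The perturbed reflected forward-backward iteration, deterministically. -/

section ReflectedForwardBackward

variable {H : Type*} [NormedAddCommGroup H] [InnerProductSpace ℝ H]

/-- Solutions of the variational inequality of the operator `T` on `K`. -/
def IsVISolution (K : Set H) (T : H → H) (p : H) : Prop :=
  p ∈ K ∧ ∀ y ∈ K, 0 ≤ inner ℝ (T p) (y - p)

theorem norm_sub_le_of_cocoercive {B : H → H} {θ : ℝ} (hθ : 0 < θ)
    (hB : ∀ u v, θ * ‖B u - B v‖ ^ 2 ≤ inner ℝ (B u - B v) (u - v)) (u v : H) :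
    ‖B u - B v‖ ≤ θ⁻¹ * ‖u - v‖ := by
  have h1 := (hB u v).trans (real_inner_le_norm _ _)
  rw [inv_mul_eq_div, le_div_iff₀ hθ]
  rcases (norm_nonneg (B u - B v)).eq_or_lt with h0 | h0
  · rw [← h0]; simp
  · nlinarith

theorem continuous_of_cocoercive {B : H → H} {θ : ℝ} (hθ : 0 < θ)
    (hB : ∀ u v, θ * ‖B u - B v‖ ^ 2 ≤ inner ℝ (B u - B v) (u - v)) : Continuous B :=
  LipschitzWith.continuous (K := ⟨θ⁻¹, (inv_pos.2 hθ).le⟩) <| LipschitzWith.of_dist_le_mul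
    fun u v => by
      rw [dist_eq_norm, dist_eq_norm]
      exact norm_sub_le_of_cocoercive hθ hB u v

/-- Testing the step at `p` and the variational inequality at `u₂` eliminates `S` by skewness. What
remains beyond the three-point identity for `Ψ` is the error of evaluating `B` at `2 u₁ - u₀` rather
than at `u₂`. -/
theorem reflected_step_descent {K : Set H} {Ψ S : H →ₗ[ℝ] H} {B : H → H} {θ : ℝ} (hθ : 0 < θ)
    (hΨ : Ψ.IsSymmetric) (hpos : ∀ w, 8 / θ * ‖w‖ ^ 2 ≤ inner ℝ (Ψ w) w)
    (hS : ∀ w, inner ℝ (S w) w = 0)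
    (hB : ∀ u v, θ * ‖B u - B v‖ ^ 2 ≤ inner ℝ (B u - B v) (u - v))
    {p u₀ u₁ u₂ e : H} (hp : IsVISolution K (fun u => B u + S u) p) (hu₂ : u₂ ∈ K)
    (hstep : ∀ y ∈ K,
      inner ℝ (Ψ (u₁ - u₂) - B ((2 : ℝ) • u₁ - u₀) - e - S u₂) (y - u₂) ≤ 0) :
    inner ℝ (Ψ (u₂ - p)) (u₂ - p) + 1 / 8 * inner ℝ (Ψ (u₂ - u₁)) (u₂ - u₁) ≤
      inner ℝ (Ψ (u₁ - p)) (u₁ - p) + 1 / 8 * inner ℝ (Ψ (u₁ - u₀)) (u₁ - u₀)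
        - 3 / 4 * inner ℝ (Ψ (u₂ - u₁)) (u₂ - u₁) + -2 * inner ℝ e (u₂ - p) := by
  have h1 := hstep p hp.1
  have h2 := hp.2 u₂ hu₂
  have h3 := hS (u₂ - p)
  set c := B ((2 : ℝ) • u₁ - u₀) - B p with hc
  set w := u₂ - ((2 : ℝ) • u₁ - u₀) with hw
  have h4 : inner ℝ c (u₂ - p) + inner ℝ e (u₂ - p) ≤ inner ℝ (Ψ (u₁ - u₂)) (u₂ - p) := by
    rw [← neg_sub u₂ p, inner_neg_right] at h1
    rw [map_sub] at h3
    simp only [hc, inner_sub_left, inner_add_left] at h1 h2 h3 ⊢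
    linarith
  have h5 : 2 * inner ℝ (Ψ (u₁ - u₂)) (u₂ - p) = inner ℝ (Ψ (u₁ - p)) (u₁ - p)
      - inner ℝ (Ψ (u₂ - p)) (u₂ - p) - inner ℝ (Ψ (u₂ - u₁)) (u₂ - u₁) := by
    have e1 : u₁ - p = (u₁ - u₂) + (u₂ - p) := by abel
    have e2 : u₂ - u₁ = -(u₁ - u₂) := by abel
    rw [e1, e2]
    simp only [map_add, map_neg, inner_add_left, inner_add_right, inner_neg_left, inner_neg_right]
    have := hΨ (u₁ - u₂) (u₂ - p)
    rw [real_inner_comm (Ψ (u₂ - p)) (u₁ - u₂)] at this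
    linarith
  -- Cocoercivity applies at the reflected point; the displacement `w` from it to `u₂` is paid for
  -- by Cauchy-Schwarz.
  have h6 : θ * ‖c‖ ^ 2 - ‖c‖ * ‖w‖ ≤ inner ℝ c (u₂ - p) := by
    have e1 : u₂ - p = ((2 : ℝ) • u₁ - u₀ - p) + w := by rw [hw]; abel
    have e2 := (abs_le.1 (abs_real_inner_le_norm c w)).1
    rw [e1, inner_add_right]
    linarith [hB ((2 : ℝ) • u₁ - u₀) p]
  have h7 : ‖w‖ ^ 2 ≤ 2 * ‖u₂ - u₁‖ ^ 2 + 2 * ‖u₁ - u₀‖ ^ 2 := by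
    have e1 : w = (u₂ - u₁) - (u₁ - u₀) := by rw [hw, two_smul]; abel
    rw [e1]
    have e2 := parallelogram_law_with_norm ℝ (u₂ - u₁) (u₁ - u₀)
    nlinarith [sq_nonneg ‖(u₂ - u₁) + (u₁ - u₀)‖]
  have h8 : ∀ v, ‖v‖ ^ 2 ≤ θ / 8 * inner ℝ (Ψ v) v := fun v => by
    have := mul_le_mul_of_nonneg_left (hpos v) (by positivity : 0 ≤ θ / 8)
    have e1 : θ / 8 * (8 / θ * ‖v‖ ^ 2) = ‖v‖ ^ 2 := by field_simp
    linarith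
  -- Completing the square gives `θ‖c‖² - ‖c‖‖w‖ ≥ -‖w‖² / (4θ)`, and by `h7` and `h8` `‖w‖²` is at
  -- most `θ / 4` times the sum of the two forms. Doubled, this loses `1/8` of each form: one is the
  -- `1/8` in the energy, and `1 - 1/8 - 1/8 = 3/4` is left for descent.
  have h9 : -(1 / 16 * (inner ℝ (Ψ (u₂ - u₁)) (u₂ - u₁) + inner ℝ (Ψ (u₁ - u₀)) (u₁ - u₀)))
      ≤ θ * ‖c‖ ^ 2 - ‖c‖ * ‖w‖ := by
    have e1 := h8 (u₂ - u₁)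
    have e2 := h8 (u₁ - u₀)
    have e3 : 0 ≤ θ * (4 * (θ * ‖c‖ ^ 2 - ‖c‖ * ‖w‖)
        + 1 / 4 * (inner ℝ (Ψ (u₂ - u₁)) (u₂ - u₁) + inner ℝ (Ψ (u₁ - u₀)) (u₁ - u₀))) := by
      nlinarith [sq_nonneg (2 * θ * ‖c‖ - ‖w‖)]
    have e4 := nonneg_of_mul_nonneg_right e3 hθ
    linarith
  linarith

/-- Opial's argument: distances to every solution converge and successive differences vanish, so
some subsequence converges, its limit is a solution, and the distance to that limit tends to `0`.
The noise sums must converge for every solution because the limit is not known in advance. -/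
theorem reflected_forward_backward_tendsto [FiniteDimensional ℝ H] {K : Set H} (hK : IsClosed K)
    {Ψ S : H →ₗ[ℝ] H} {B : H → H} {θ : ℝ} (hθ : 0 < θ)
    (hΨ : Ψ.IsSymmetric) (hpos : ∀ w, 8 / θ * ‖w‖ ^ 2 ≤ inner ℝ (Ψ w) w)
    (hS : ∀ w, inner ℝ (S w) w = 0)
    (hB : ∀ u v, θ * ‖B u - B v‖ ^ 2 ≤ inner ℝ (B u - B v) (u - v))
    (hsol : ∃ p, IsVISolution K (fun u => B u + S u) p)
    {u e : ℕ → H} (hmem : ∀ k, u (k + 2) ∈ K)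
    (hstep : ∀ k, ∀ y ∈ K, inner ℝ (Ψ (u (k + 1) - u (k + 2)) - B ((2 : ℝ) • u (k + 1) - u k)
      - e k - S (u (k + 2))) (y - u (k + 2)) ≤ 0)
    (he : Tendsto e atTop (𝓝 0))
    (hsum : ∀ p, IsVISolution K (fun u => B u + S u) p →
      ∃ l, Tendsto (fun j => ∑ k ∈ Finset.range j, inner ℝ (e k) (u (k + 2) - p)) atTop (𝓝 l)) :
    ∃ p, IsVISolution K (fun u => B u + S u) p ∧ Tendsto u atTop (𝓝 p) := by
  have hq0 : ∀ w, 0 ≤ inner ℝ (Ψ w) w := fun w => le_trans (by positivity) (hpos w)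
  have hΨc : Continuous Ψ := Ψ.continuous_of_finiteDimensional
  have hSc : Continuous S := S.continuous_of_finiteDimensional
  have hBc : Continuous B := continuous_of_cocoercive hθ hB
  have hconv : ∀ w : ℕ → H, Tendsto (fun k => inner ℝ (Ψ (w k)) (w k)) atTop (𝓝 0) →
      Tendsto w atTop (𝓝 0) := fun w hw => by
    have h1 : Tendsto (fun k => ‖w k‖ ^ 2) atTop (𝓝 0) := by
      refine squeeze_zero (fun k => sq_nonneg _) (fun k => ?_)
        (by simpa using hw.const_mul (θ / 8))
      have := mul_le_mul_of_nonneg_left (hpos (w k)) (by positivity : 0 ≤ θ / 8)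
      have e1 : θ / 8 * (8 / θ * ‖w k‖ ^ 2) = ‖w k‖ ^ 2 := by field_simp
      linarith
    have h2 := (Real.continuous_sqrt.tendsto 0).comp h1
    rw [Real.sqrt_zero] at h2
    exact tendsto_zero_iff_norm_tendsto_zero.2
      (h2.congr fun k => by simp [Real.sqrt_sq (norm_nonneg _)])
  have key : ∀ p, IsVISolution K (fun u => B u + S u) p →
      (∃ l, Tendsto (fun k => inner ℝ (Ψ (u (k + 1) - p)) (u (k + 1) - p)) atTop (𝓝 l)) ∧
        Tendsto (fun k => u (k + 1) - u k) atTop (𝓝 0) := fun p hp => by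
    obtain ⟨l, hl⟩ := hsum p hp
    have hl' : Tendsto (fun j => ∑ k ∈ Finset.range j, -2 * inner ℝ (e k) (u (k + 2) - p))
        atTop (𝓝 (-2 * l)) := by
      simpa only [← Finset.mul_sum] using hl.const_mul (-2)
    obtain ⟨⟨v, hv⟩, hs⟩ := tendsto_and_summable_of_quasi_descent
      (V := fun k => inner ℝ (Ψ (u (k + 1) - p)) (u (k + 1) - p)
        + 1 / 8 * inner ℝ (Ψ (u (k + 1) - u k)) (u (k + 1) - u k))
      (a := fun k => 3 / 4 * inner ℝ (Ψ (u (k + 2) - u (k + 1))) (u (k + 2) - u (k + 1)))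
      (fun k => by linarith [hq0 (u (k + 1) - p), hq0 (u (k + 1) - u k)])
      (fun k => by linarith [hq0 (u (k + 2) - u (k + 1))])
      (fun k => reflected_step_descent hθ hΨ hpos hS hB hp (hmem k) (hstep k)) hl'
    -- The summable decrements control `u (k + 2) - u (k + 1)`, hence the shift by one.
    have hd : Tendsto (fun k => inner ℝ (Ψ (u (k + 1) - u k)) (u (k + 1) - u k)) atTop (𝓝 0) := by
      rw [← tendsto_add_atTop_iff_nat 1]
      have := hs.tendsto_atTop_zero.const_mul (4 / 3)
      rw [mul_zero] at this
      exact this.congr fun k => by ring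
    refine ⟨⟨v, ?_⟩, hconv _ hd⟩
    have := hv.sub (hd.const_mul (1 / 8))
    rw [mul_zero, sub_zero] at this
    exact this.congr fun k => by ring
  obtain ⟨p₀, hp₀⟩ := hsol
  obtain ⟨⟨l₀, hl₀⟩, hdiff⟩ := key p₀ hp₀
  obtain ⟨R, hR⟩ := hl₀.bddAbove_range
  have hbound : ∀ k, u (k + 1) ∈ Metric.closedBall p₀ (Real.sqrt (θ / 8 * R)) := fun k => by
    rw [mem_closedBall_iff_norm]
    refine Real.le_sqrt_of_sq_le ?_
    have h1 := (hpos (u (k + 1) - p₀)).trans (hR ⟨k, rfl⟩)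
    have := mul_le_mul_of_nonneg_left h1 (by positivity : 0 ≤ θ / 8)
    have e1 : θ / 8 * (8 / θ * ‖u (k + 1) - p₀‖ ^ 2) = ‖u (k + 1) - p₀‖ ^ 2 := by field_simp
    linarith
  have : ProperSpace H := FiniteDimensional.proper ℝ H
  obtain ⟨p, -, φ, hφ, hlim⟩ := tendsto_subseq_of_bounded Metric.isBounded_closedBall hbound
  have hφt := hφ.tendsto_atTop
  have hlim0 : Tendsto (fun j => u (φ j)) atTop (𝓝 p) := by
    have := hlim.sub (hdiff.comp hφt)
    rw [sub_zero] at this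
    exact this.congr fun j => by simp
  have hlim2 : Tendsto (fun j => u (φ j + 2)) atTop (𝓝 p) := by
    have := hlim.add (hdiff.comp ((tendsto_add_atTop_nat 1).comp hφt))
    rw [add_zero] at this
    exact this.congr fun j => by simp
  -- Along the subsequence the three consecutive iterates share the limit `p`, so the reflected
  -- point also tends to `p` and the step inequality passes to the limit.
  have hp : IsVISolution K (fun u => B u + S u) p := by
    refine ⟨hK.mem_of_tendsto hlim2 (Eventually.of_forall fun j => hmem _), fun y hy => ?_⟩
    have h1 : Tendsto (fun j => Ψ (u (φ j + 1) - u (φ j + 2))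
        - B ((2 : ℝ) • u (φ j + 1) - u (φ j)) - e (φ j) - S (u (φ j + 2))) atTop
        (𝓝 (Ψ (p - p) - B ((2 : ℝ) • p - p) - 0 - S p)) :=
      ((((hΨc.tendsto _).comp (hlim.sub hlim2)).sub
        ((hBc.tendsto _).comp ((hlim.const_smul (2 : ℝ)).sub hlim0))).sub (he.comp hφt)).sub
        ((hSc.tendsto _).comp hlim2)
    have h2 := le_of_tendsto (h1.inner (tendsto_const_nhds (x := y) |>.sub hlim2))
      (Eventually.of_forall fun j => hstep (φ j) y hy)
    have h3 : Ψ (p - p) - B ((2 : ℝ) • p - p) - 0 - S p = -(B p + S p) := by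
      rw [sub_self, map_zero, two_smul, add_sub_cancel_right]; abel
    rw [h3, inner_neg_left] at h2
    linarith
  obtain ⟨⟨l, hl⟩, -⟩ := key p hp
  have hl0 : l = 0 := by
    refine tendsto_nhds_unique (hl.comp hφt) ?_
    have h1 : Tendsto (fun j => u (φ j + 1) - p) atTop (𝓝 0) := by
      simpa using hlim.sub_const p
    have h2 : Tendsto (fun j => inner ℝ (Ψ (u (φ j + 1) - p)) (u (φ j + 1) - p)) atTop
        (𝓝 (inner ℝ (Ψ 0) (0 : H))) := Filter.Tendsto.inner ((hΨc.tendsto 0).comp h1) h1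
    rw [inner_zero_right] at h2
    exact h2
  refine ⟨p, hp, ?_⟩
  rw [← tendsto_add_atTop_iff_nat 1]
  have := hconv _ (hl0 ▸ hl)
  simpa using this.add_const p

end ReflectedForwardBackward

/-! ### Solutions of cocoercive variational inequalities on compact convex sets. -/

section Existence

variable {H : Type*} [NormedAddCommGroup H] [InnerProductSpace ℝ H]

/-- The contraction `(1 - s) T + s x₀` has a fixed point in `K` which `T` moves by at most `2 R s`.
Letting `s → 0`, the minimum of `‖T x - x‖` over the compact set `K` is zero. -/
theorem exists_fixedPoint_of_nonexpansive [CompleteSpace H] {K : Set H} (hc : IsCompact K)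
    (hne : K.Nonempty) (hco : Convex ℝ K) {T : H → H} (hT : ∀ x, T x ∈ K)
    (hlip : LipschitzWith 1 T) : ∃ x ∈ K, T x = x := by
  obtain ⟨x₀, hx₀⟩ := hne
  obtain ⟨R, hR⟩ := hc.isBounded.exists_norm_le
  obtain ⟨x, hx, hmin⟩ := hc.exists_isMinOn ⟨x₀, hx₀⟩
    ((hlip.continuous.sub continuous_id).norm.continuousOn)
  have hle : ∀ s : ℝ, 0 < s → s < 1 → ‖T x - x‖ ≤ s * (2 * R) := fun s hs hs1 => by
    set f : H → H := fun y => (1 - s) • T y + s • x₀ with hf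
    have hcontr : ContractingWith (1 - s).toNNReal f := by
      refine ⟨?_, LipschitzWith.of_dist_le_mul fun y z => ?_⟩
      · rw [Real.toNNReal_lt_one]; linarith
      · have h1 := hlip.dist_le_mul y z
        rw [NNReal.coe_one, one_mul, dist_eq_norm] at h1
        rw [dist_eq_norm]
        have h2 : f y - f z = (1 - s) • (T y - T z) := by rw [hf]; module
        rw [h2, norm_smul, Real.norm_of_nonneg (by linarith), Real.coe_toNNReal _ (by linarith)]
        exact mul_le_mul_of_nonneg_left h1 (by linarith)
    obtain ⟨y, hy, -⟩ := hcontr.exists_fixedPoint x₀ (edist_ne_top _ _)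
    have hy' : (1 - s) • T y + s • x₀ = y := hy
    have hyK : y ∈ K := hy' ▸ hco (hT y) hx₀ (by linarith) hs.le (by ring)
    have h3 : T y - y = s • (T y - x₀) := by
      nth_rewrite 2 [← hy']
      module
    calc ‖T x - x‖ ≤ ‖T y - y‖ := hmin hyK
      _ = s * ‖T y - x₀‖ := by rw [h3, norm_smul, Real.norm_of_nonneg hs.le]
      _ ≤ s * (2 * R) := by
        refine mul_le_mul_of_nonneg_left ?_ hs.le
        have := norm_sub_le (T y) x₀
        linarith [hR _ (hT y), hR _ hx₀]
  refine ⟨x, hx, sub_eq_zero.1 (norm_eq_zero.1 (le_antisymm ?_ (norm_nonneg _)))⟩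
  have h1 : Tendsto (fun s : ℝ => s * (2 * R)) (𝓝[>] 0) (𝓝 0) := by
    have : Tendsto (fun s : ℝ => s * (2 * R)) (𝓝 0) (𝓝 (0 * (2 * R))) :=
      (continuous_id.mul continuous_const).tendsto 0
    rw [zero_mul] at this
    exact this.mono_left nhdsWithin_le_nhds
  refine ge_of_tendsto h1 ?_
  filter_upwards [Ioo_mem_nhdsGT (zero_lt_one' ℝ)] with s hs
  exact hle s hs.1 hs.2

/-- By cocoercivity the forward step `x - θ B x` is nonexpansive, hence so is its projection onto
`K`, and the fixed points of the composition are the solutions. -/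
theorem exists_isVISolution_of_cocoercive [CompleteSpace H] {K : Set H} (hc : IsCompact K)
    (hne : K.Nonempty) (hco : Convex ℝ K) {B : H → H} {θ : ℝ} (hθ : 0 < θ)
    (hB : ∀ u v, θ * ‖B u - B v‖ ^ 2 ≤ inner ℝ (B u - B v) (u - v)) :
    ∃ p, IsVISolution K B p := by
  have hex : ∀ p : H, ∃ q ∈ K, ∀ y ∈ K, inner ℝ (p - q) (y - q) ≤ 0 := fun p => by
    obtain ⟨q, hq, hmin⟩ := exists_norm_eq_iInf_of_complete_convex hne hc.isComplete hco p
    exact ⟨q, hq, (norm_eq_iInf_iff_real_inner_le_zero hco hq).1 hmin⟩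
  choose pr hpr hpr' using hex
  obtain ⟨x, hx, hfix⟩ := exists_fixedPoint_of_nonexpansive hc hne hco
    (T := fun x => pr (x - θ • B x)) (fun x => hpr _) <| LipschitzWith.of_dist_le_mul fun x y => by
      rw [NNReal.coe_one, one_mul, dist_eq_norm, dist_eq_norm]
      refine (norm_sub_le_of_obtuse (hpr' _ _ (hpr _)) (hpr' _ _ (hpr _))).trans ?_
      refine le_of_sq_le_sq ?_ (norm_nonneg _)
      have h1 : x - θ • B x - (y - θ • B y) = (x - y) - θ • (B x - B y) := by module
      rw [h1, norm_sub_sq_real, norm_smul, Real.norm_of_nonneg hθ.le, real_inner_smul_right,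
        real_inner_comm]
      nlinarith [mul_le_mul_of_nonneg_left (hB x y) hθ.le, sq_nonneg (θ * ‖B x - B y‖)]
  refine ⟨x, hx, fun y hy => ?_⟩
  have h1 := hpr' (x - θ • B x) y hy
  rw [hfix, sub_sub_cancel_left, inner_neg_left, real_inner_smul_left] at h1
  exact nonneg_of_mul_nonneg_right (by linarith : 0 ≤ θ * inner ℝ (B x) (y - x)) hθ

end Existence

theorem nonneg_of_forall_add_mul_pos {X Y : ℝ} (h : ∀ δ > 0, 0 < X + δ * Y) : 0 ≤ X := by
  by_contra! hX
  have h1 := h (-X / (|Y| + 1)) (div_pos (neg_pos.2 hX) (by positivity))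
  have h2 : -X / (|Y| + 1) * Y ≤ -X / (|Y| + 1) * |Y| :=
    mul_le_mul_of_nonneg_left (le_abs_self Y) (div_nonneg (neg_pos.2 hX).le (by positivity))
  have h3 : -X / (|Y| + 1) * (|Y| + 1) = -X := div_mul_cancel₀ _ (by positivity)
  have h4 : 0 < -X / (|Y| + 1) := div_pos (neg_pos.2 hX) (by positivity)
  nlinarith

theorem nonneg_of_forall_nonneg_add_mul {X Y : ℝ} (h : ∀ s > 0, 0 ≤ X + s * Y) : 0 ≤ Y := by
  by_contra! hY
  have h1 := h ((|X| + 1) / -Y) (div_pos (by positivity) (neg_pos.2 hY))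
  have h2 : (|X| + 1) / -Y * Y = -(|X| + 1) := by
    have := hY.ne
    field_simp
  rw [h2] at h1
  linarith [le_abs_self X]

/-! ### The coupling constraint and Lagrange multipliers. -/

namespace Game

variable {N m d : ℕ} {n : Fin N → ℕ} (G : Game N m d n)

theorem coupling_apply (x : Profile n) (r : Fin m) :
    G.coupling x r = ∑ i, mulE (G.A i) (x i) r := by
  simp [coupling]

theorem coupling_add (x y : Profile n) : G.coupling (x + y) = G.coupling x + G.coupling y := by
  simp [coupling, mulE_add, Finset.sum_add_distrib]

theorem coupling_sub (x y : Profile n) : G.coupling (x - y) = G.coupling x - G.coupling y := by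
  simp [coupling, mulE_sub, Finset.sum_sub_distrib]

theorem coupling_smul (t : ℝ) (x : Profile n) : G.coupling (t • x) = t • G.coupling x := by
  simp [coupling, mulE_smul, Finset.smul_sum]

theorem continuous_coupling : Continuous G.coupling := by
  unfold coupling
  exact continuous_finsetSum _ fun i _ => (continuous_mulE _).comp (by fun_prop)

theorem inner_coupling (x : Profile n) (l : Euc m) : inner ℝ (G.coupling x) l =
    inner ℝ (blockMapT G.A (WithLp.toLp 2 fun _ => l)) x := by
  rw [coupling, sum_inner, inner_profile]
  refine Finset.sum_congr rfl fun i _ => ?_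
  rw [inner_mulE_left, real_inner_comm, blockMapT_apply]

variable {G}

theorem ConstraintAssumption.convex_localSet (hX : G.ConstraintAssumption) :
    Convex ℝ G.localSet := fun _ hx _ hy _ _ ha hb hab i => hX.convex i (hx i) (hy i) ha hb hab

theorem ConstraintAssumption.isCompact_localSet (hX : G.ConstraintAssumption) :
    IsCompact G.localSet := by
  have h : IsCompact (Set.univ.pi G.Ω) := isCompact_univ_pi hX.compact
  have h2 := h.image (PiLp.continuous_toLp 2 fun i => Euc (n i))
  convert h2 using 1
  ext x
  constructor
  · exact fun hx => ⟨WithLp.ofLp x, fun i _ => hx i, rfl⟩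
  · rintro ⟨y, hy, rfl⟩ i
    exact hy i trivial

theorem ConstraintAssumption.isClosed_feasible (hX : G.ConstraintAssumption) :
    IsClosed G.feasible := by
  have : G.feasible = G.localSet ∩ ⋂ r, {x | G.coupling x r ≤ G.b r} := by
    ext; simp [feasible]
  rw [this]
  refine hX.isCompact_localSet.isClosed.inter (isClosed_iInter fun r => ?_)
  refine isClosed_le ?_ continuous_const
  have := G.continuous_coupling
  fun_prop

theorem ConstraintAssumption.convex_feasible (hX : G.ConstraintAssumption) :
    Convex ℝ G.feasible := by
  intro x hx y hy a b ha hb hab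
  refine ⟨hX.convex_localSet hx.1 hy.1 ha hb hab, fun r => ?_⟩
  rw [coupling_add, coupling_smul, coupling_smul]
  have h1 := mul_le_mul_of_nonneg_left (hx.2 r) ha
  have h2 := mul_le_mul_of_nonneg_left (hy.2 r) hb
  have h3 : a * G.b r + b * G.b r = G.b r := by rw [← add_mul, hab, one_mul]
  simp only [PiLp.add_apply, PiLp.smul_apply, smul_eq_mul]
  linarith

/-- Lagrange multipliers for a linear cost on the feasible set, under Slater's condition. -/
theorem ConstraintAssumption.exists_multiplier (hX : G.ConstraintAssumption) {c x : Profile n}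
    (hx : x ∈ G.feasible) (hmin : ∀ y ∈ G.feasible, 0 ≤ inner ℝ c (y - x)) :
    ∃ l ∈ orthant m, inner ℝ l (G.b - G.coupling x) = 0 ∧
      ∀ y ∈ G.localSet, 0 ≤ inner ℝ c (y - x) + inner ℝ l (G.coupling (y - x)) := by
  -- The strict epigraph of constraint values and cost increments over `Ω`. Optimality of `x` keeps
  -- the origin out of it, and a hyperplane separating the origin from it has the multiplier as its
  -- normal.
  set S : Set (Euc m × ℝ) := ⋃ y ∈ G.localSet,
    {q | (∀ r, (G.coupling y - G.b) r < q.1 r) ∧ inner ℝ c (y - x) < q.2} with hS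
  have hSo : IsOpen S := by
    refine isOpen_biUnion fun y _ => ?_
    have : {q : Euc m × ℝ | (∀ r, (G.coupling y - G.b) r < q.1 r) ∧ inner ℝ c (y - x) < q.2}
        = (⋂ r, {q | (G.coupling y - G.b) r < q.1 r}) ∩ {q | inner ℝ c (y - x) < q.2} := by
      ext; simp
    rw [this]
    refine (isOpen_iInter_of_finite fun r => isOpen_lt continuous_const (by fun_prop)).inter
      (isOpen_lt continuous_const continuous_snd)
  have hSc : Convex ℝ S := by
    intro p hp q hq a b ha hb hab
    simp only [hS, Set.mem_iUnion, Set.mem_ofPred_eq, exists_prop] at hp hq ⊢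
    obtain ⟨y, hy, hy1, hy2⟩ := hp
    obtain ⟨z, hz, hz1, hz2⟩ := hq
    have hcomb : ∀ {s s' t t' : ℝ}, s < s' → t < t' → a * s + b * t < a * s' + b * t' := by
      intro s s' t t' h1 h2
      rcases ha.eq_or_lt with rfl | ha
      · have : b = 1 := by linarith
        subst this; linarith
      · have := mul_lt_mul_of_pos_left h1 ha
        have := mul_le_mul_of_nonneg_left h2.le hb
        linarith
    refine ⟨a • y + b • z, hX.convex_localSet hy hz ha hb hab, fun r => ?_, ?_⟩
    · have h1 := hcomb (hy1 r) (hz1 r)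
      have h3 : a * G.b r + b * G.b r = G.b r := by rw [← add_mul, hab, one_mul]
      rw [coupling_add, coupling_smul, coupling_smul]
      simp only [PiLp.add_apply, PiLp.sub_apply, PiLp.smul_apply, smul_eq_mul, Prod.fst_add,
        Prod.smul_fst] at h1 ⊢
      linarith
    · have h1 := hcomb hy2 hz2
      have h2 : a • y + b • z - x = a • (y - x) + b • (z - x) := by
        have : x = a • x + b • x := by rw [← add_smul, hab, one_smul]
        nth_rewrite 1 [this]
        module
      rw [h2, inner_add_right, real_inner_smul_right, real_inner_smul_right]
      simpa using h1
  have h0 : (0 : Euc m × ℝ) ∉ S := by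
    simp only [hS, Set.mem_iUnion, Set.mem_ofPred_eq, exists_prop, not_exists, not_and]
    intro y hy h1 h2
    have h3 : y ∈ G.feasible := ⟨hy, fun r => by have := h1 r; simp at this; exact this.le⟩
    exact absurd (hmin y h3) (not_le.2 h2)
  obtain ⟨f, hf⟩ := geometric_hahn_banach_open_point hSc hSo h0
  set w : Euc m := (InnerProductSpace.toDual ℝ (Euc m)).symm
    (f.comp (ContinuousLinearMap.inl ℝ (Euc m) ℝ)) with hw
  set ρ : ℝ := -f (0, 1) with hρ
  have hfw : ∀ v t, f (v, t) = inner ℝ w v - ρ * t := fun v t => by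
    have h1 : ((v, t) : Euc m × ℝ) = (v, 0) + t • (0, 1) := by simp
    rw [h1, map_add, map_smul, hw, InnerProductSpace.toDual_symm_apply, hρ]
    simp [mul_comm]
  have hpos : ∀ y ∈ G.localSet, ∀ v t, (∀ r, (G.coupling y - G.b) r < v r) →
      inner ℝ c (y - x) < t → 0 < inner ℝ (-w) v + ρ * t := fun y hy v t hv ht => by
    have h1 := hf (v, t) (by
      simp only [hS, Set.mem_iUnion, Set.mem_ofPred_eq, exists_prop]
      exact ⟨y, hy, hv, ht⟩)
    rw [map_zero, hfw] at h1
    rw [inner_neg_left]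
    linarith
  have hnn : ∀ y ∈ G.localSet, ∀ v t, (∀ r, (G.coupling y - G.b) r ≤ v r) →
      inner ℝ c (y - x) ≤ t → 0 ≤ inner ℝ (-w) v + ρ * t := fun y hy v t hv ht => by
    -- Raising every coordinate by `δ` makes the inequalities strict; then `δ → 0`.
    refine nonneg_of_forall_add_mul_pos
      (Y := inner ℝ (-w) (WithLp.toLp 2 fun _ => 1 : Euc m) + ρ) fun δ hδ => ?_
    have h1 := hpos y hy (v + δ • (WithLp.toLp 2 fun _ => 1 : Euc m)) (t + δ)
      (fun r => by have := hv r; simp at this ⊢; linarith) (by linarith)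
    rw [inner_add_right, real_inner_smul_right] at h1
    linarith
  -- At a Slater point `v = 0` is admissible, so the `w` term drops out and the hyperplane cannot be
  -- vertical.
  have hρpos : 0 < ρ := by
    obtain ⟨y, hy, hy'⟩ := hX.slater
    have h1 := hpos y hy 0 (|inner ℝ c (y - x)| + 1) (fun r => by simpa using hy' r)
      (by linarith [le_abs_self (inner ℝ c (y - x))])
    rw [inner_zero_right, zero_add] at h1
    exact pos_of_mul_pos_left h1 (by positivity)
  -- The set is unbounded in each direction `e_r`, so a negative coordinate would violate `hnn` for
  -- large `s`.
  have hwnn : ∀ r, 0 ≤ (-w) r := fun r => by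
    refine nonneg_of_forall_nonneg_add_mul (X := inner ℝ (-w) (G.coupling x - G.b)) fun s hs => ?_
    have h1 := hnn x hx.1 (G.coupling x - G.b + s • EuclideanSpace.single r 1) 0
      (fun r' => by
        simp only [PiLp.add_apply, PiLp.smul_apply, le_add_iff_nonneg_right, smul_eq_mul]
        refine mul_nonneg hs.le ?_
        rw [PiLp.single_apply]
        split_ifs <;> norm_num) (by simp)
    rw [inner_add_right, real_inner_smul_right, EuclideanSpace.inner_single_right] at h1
    simpa using h1
  have hcompl : inner ℝ (-w) (G.b - G.coupling x) = 0 := by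
    have h1 := hnn x hx.1 (G.coupling x - G.b) 0 (fun r => le_rfl) (by simp)
    rw [← neg_sub, inner_neg_right] at h1
    refine le_antisymm (by linarith) ?_
    rw [PiLp.inner_apply]
    refine Finset.sum_nonneg fun r _ => ?_
    have h2 : 0 ≤ (G.b - G.coupling x) r := sub_nonneg.2 (hx.2 r)
    simpa [mul_comm] using mul_nonneg (hwnn r) h2
  refine ⟨ρ⁻¹ • (-w), fun r => mul_nonneg (inv_nonneg.2 hρpos.le) (hwnn r), ?_, fun y hy => ?_⟩
  · rw [real_inner_smul_left, hcompl, mul_zero]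
  · have h1 := hnn y hy (G.coupling y - G.b) _ (fun r => le_rfl) le_rfl
    have h2 : G.coupling y - G.b = G.coupling (y - x) - (G.b - G.coupling x) := by
      rw [coupling_sub]; abel
    rw [h2, inner_sub_right, hcompl, sub_zero] at h1
    rw [real_inner_smul_left]
    have h3 := mul_nonneg (inv_nonneg.2 hρpos.le) h1
    rw [mul_add, inv_mul_cancel_left₀ hρpos.ne'] at h3
    linarith

end Game

theorem hasDerivAt_line {E : Type*} [NormedAddCommGroup E] [InnerProductSpace ℝ E]
    [CompleteSpace E] {f : E → ℝ} {x : E} (hd : DifferentiableAt ℝ f x) (v : E) :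
    HasDerivAt (fun t : ℝ => f (x + t • v)) (inner ℝ (gradient f x) v) 0 := by
  have h2 := hd.hasGradientAt.hasFDerivAt
  have h3 : HasDerivAt (fun t : ℝ => x + t • v) v 0 := by
    simpa using ((hasDerivAt_id (0 : ℝ)).smul_const v).const_add x
  have h4 := HasFDerivAt.comp_hasDerivAt (f := fun t : ℝ => x + t • v) (0 : ℝ)
    (by simpa using h2) h3
  simpa [Function.comp_def] using h4

theorem convexOn_gradient_le {E : Type*} [NormedAddCommGroup E] [InnerProductSpace ℝ E]
    [CompleteSpace E] {s : Set E} {f : E → ℝ} (hf : ConvexOn ℝ s f) {x y : E} (hx : x ∈ s)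
    (hy : y ∈ s) (hd : DifferentiableAt ℝ f x) :
    f x + inner ℝ (gradient f x) (y - x) ≤ f y := by
  have h5 := (hasDerivAt_line hd (y - x)).tendsto_slope_zero_right
  have h6 : inner ℝ (gradient f x) (y - x) ≤ f y - f x := by
    refine le_of_tendsto h5 ?_
    filter_upwards [Ioo_mem_nhdsGT (zero_lt_one' ℝ)] with t ht
    have h7 := hf.2 hx hy (sub_nonneg.2 ht.2.le) ht.1.le (by ring)
    have h8 : (1 - t) • x + t • y = x + t • (y - x) := by module
    rw [h8] at h7
    simp only [smul_eq_mul, zero_add, zero_smul, add_zero] at h7 ⊢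
    rw [inv_mul_le_iff₀ ht.1]
    linarith
  linarith

@[simp] theorem replace_apply_self {N : ℕ} {n : Fin N → ℕ} (x : Profile n) (i : Fin N)
    (y : Euc (n i)) : replace x i y i = y := by
  simp [replace]

theorem replace_apply_of_ne {N : ℕ} {n : Fin N → ℕ} (x : Profile n) {i j : Fin N} (h : j ≠ i)
    (y : Euc (n i)) : replace x i y j = x j := by
  simp [replace, h]

@[simp] theorem replace_self {N : ℕ} {n : Fin N → ℕ} (x : Profile n) (i : Fin N) :
    replace x i (x i) = x := by
  simp [replace]

/-! ### Equilibria and the KKT variational inequality. -/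

namespace Game

variable {N m d : ℕ} {n : Fin N → ℕ} {G : Game N m d n} {𝒢 : SimpleGraph (Fin N)}
  {W : Matrix (Fin N) (Fin N) ℝ} {Ξ : Type*} [MeasurableSpace Ξ] {P : Measure Ξ} {ξ : Ξ → Euc d}

theorem pseudograd_apply (x : Profile n) (i : Fin N) :
    G.pseudograd P ξ x i = ∫ w, G.partialGrad i x (ξ w) ∂P := rfl

theorem mem_localSet_replace {x : Profile n} (hx : x ∈ G.localSet) {i : Fin N} {y : Euc (n i)}
    (hy : y ∈ G.Ω i) : replace x i y ∈ G.localSet := fun j => by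
  rcases eq_or_ne j i with rfl | h
  · simpa using hy
  · rw [replace_apply_of_ne x h]
    exact hx j

theorem CostAssumption.differentiable (hJ : G.CostAssumption P ξ) (i : Fin N) (x : Profile n)
    (u : Euc d) : Differentiable ℝ fun y => G.J i (replace x i y) u :=
  (hJ.contDiff i x u).differentiable one_ne_zero

/-- The gradient inequality is applied to each sample cost and then integrated, so no derivative is
exchanged with the expectation. -/
theorem CostAssumption.expCost_add_inner_le (hJ : G.CostAssumption P ξ) {i : Fin N} {x : Profile n}
    (hx : x ∈ G.localSet) {y : Euc (n i)} (hy : y ∈ G.Ω i) :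
    G.expCost P ξ i x + inner ℝ (G.pseudograd P ξ x i) (y - x i)
      ≤ G.expCost P ξ i (replace x i y) := by
  have h1 : inner ℝ (G.pseudograd P ξ x i) (y - x i)
      = ∫ w, inner ℝ (G.partialGrad i x (ξ w)) (y - x i) ∂P := by
    rw [pseudograd_apply, real_inner_comm, ← integral_inner (hJ.grad_integrable i x)]
    simp only [real_inner_comm]
  have h2 : Integrable (fun w => inner ℝ (G.partialGrad i x (ξ w)) (y - x i)) P :=
    (hJ.grad_integrable i x).inner_const _
  rw [h1, expCost, expCost, ← integral_add (hJ.integrable i x hx) h2]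
  refine integral_mono ((hJ.integrable i x hx).add h2)
    (hJ.integrable i _ (mem_localSet_replace hx hy)) fun w => ?_
  have h3 := convexOn_gradient_le (hJ.convex i x hx (ξ w)) (hx i) hy
    (hJ.differentiable i x (ξ w) (x i))
  simpa [partialGrad] using h3

/-- A unilateral admissible deviation remains collectively feasible, and testing the variational
inequality there leaves only the block of the deviating agent. -/
theorem CostAssumption.isVariationalSGNE (hJ : G.CostAssumption P ξ) {x : Profile n}
    (hx : G.SolvesSVI P ξ x) : G.IsVariationalSGNE P ξ x := by
  refine ⟨⟨hx.1, fun i y hy => ?_⟩, hx⟩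
  have h1 : replace x i y ∈ G.feasible := by
    refine ⟨mem_localSet_replace hx.1.1 hy.1, fun r => ?_⟩
    rw [coupling_apply, ← Finset.add_sum_erase _ _ (Finset.mem_univ i), replace_apply_self]
    have h2 : ∑ j ∈ Finset.univ.erase i, mulE (G.A j) (replace x i y j) r
        = ∑ j ∈ Finset.univ.erase i, mulE (G.A j) (x j) r :=
      Finset.sum_congr rfl fun j hj => by rw [replace_apply_of_ne x (Finset.ne_of_mem_erase hj)]
    rw [h2]
    linarith [hy.2 r]
  have h2 := hx.2 _ h1
  rw [inner_profile, Finset.sum_eq_single i] at h2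
  · rw [PiLp.sub_apply, replace_apply_self] at h2
    linarith [hJ.expCost_add_inner_le hx.1.1 hy.1]
  · intro j _ hj
    rw [PiLp.sub_apply, replace_apply_of_ne x hj, sub_self, inner_zero_right]
  · simp

variable (G) in
/-- The cocoercive part of the KKT operator. -/
def forward (P : Measure Ξ) (ξ : Ξ → Euc d) (W : Matrix (Fin N) (Fin N) ℝ) (bl : Dual N m)
    (u : Ext n m) : Ext n m :=
  triple (G.pseudograd P ξ u.fst) 0 (lap W u.snd.snd + WithLp.toLp 2 bl)

variable (G) in
/-- The triples `(x, z, λ)` with `x ∈ Ω` and `λ ≥ 0`. -/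
def kktSet : Set (Ext n m) := {u | u.fst ∈ G.localSet ∧ ∀ i, u.snd.snd i ∈ orthant m}

/-- The operator is block diagonal up to the constant `bl`, so the two cocoercivity bounds add up;
`θ ≤ β` serves the pseudogradient and `2 d_i θ ≤ 1` the Laplacian. -/
theorem forward_cocoercive (hW : GraphAssumption 𝒢 W) {β θ : ℝ} (hF : G.IsCocoercive P ξ β)
    (hθ : 0 < θ) (hθβ : θ ≤ β) (hd : ∀ i, 2 * degree W i * θ ≤ 1) (bl : Dual N m)
    (u v : Ext n m) : θ * ‖G.forward P ξ W bl u - G.forward P ξ W bl v‖ ^ 2 ≤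
      inner ℝ (G.forward P ξ W bl u - G.forward P ξ W bl v) (u - v) := by
  have h1 := hF u.fst v.fst
  have h2 := hW.lap_cocoercive hθ hd (u.snd.snd - v.snd.snd)
  have h3 := mul_le_mul_of_nonneg_right hθβ
    (sq_nonneg ‖G.pseudograd P ξ u.fst - G.pseudograd P ξ v.fst‖)
  rw [map_sub] at h2
  simp only [norm_ext_sq, inner_ext, forward, WithLp.sub_fst, WithLp.sub_snd, triple_fst,
    triple_snd_fst, triple_snd_snd, add_sub_add_right_eq_sub, sub_self, norm_zero, inner_zero_left]
  linarith

theorem ConstraintAssumption.isClosed_kktSet (hX : G.ConstraintAssumption) :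
    IsClosed G.kktSet := by
  have h1 : Continuous fun u : Ext n m => u.fst :=
    continuous_fst.comp (WithLp.prod_continuous_ofLp 2 _ _)
  have h2 : Continuous fun u : Ext n m => u.snd :=
    continuous_snd.comp (WithLp.prod_continuous_ofLp 2 _ _)
  have h3 : Continuous fun u : Ext n m => u.snd.snd :=
    (continuous_snd.comp (WithLp.prod_continuous_ofLp 2 _ _)).comp h2
  have h4 : G.kktSet = {u | u.fst ∈ G.localSet} ∩ ⋂ i, {u | u.snd.snd i ∈ orthant m} := by
    ext; simp [kktSet]
  rw [h4]
  refine (hX.isCompact_localSet.isClosed.preimage h1).inter (isClosed_iInter fun i => ?_)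
  exact (isClosed_orthant m).preimage (by fun_prop : Continuous fun u : Ext n m => u.snd.snd i)

theorem inner_nonneg_of_orthant {v w : Euc m} (hv : v ∈ orthant m) (hw : ∀ r, 0 ≤ w r) :
    0 ≤ inner ℝ v w := by
  rw [PiLp.inner_apply]
  exact Finset.sum_nonneg fun r _ => by simpa [mul_comm] using mul_nonneg (hv r) (hw r)

theorem sum_blockMap (x : Profile n) : ∑ i, blockMap G.A x i = G.coupling x := rfl

theorem sum_lap (hs : W.IsSymm) (z : Stack N m) : ∑ i, lap W z i = 0 := by
  refine ext_inner_right ℝ fun c => ?_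
  have h1 := isSymmetric_lap (m := m) hs z (WithLp.toLp 2 fun _ => c)
  rw [lap_const, inner_zero_right, inner_stack] at h1
  rw [sum_inner, inner_zero_left]
  exact h1

/-- Take a solution `x` of the original variational inequality and give every agent the same
multiplier `l`. The variable `z` redistributes the local residuals `b_i - A_i x_i` so that each
agent sees an equal share of the global slack. -/
theorem ConstraintAssumption.exists_kkt (hX : G.ConstraintAssumption) (hW : GraphAssumption 𝒢 W)
    {β : ℝ} (hβ : 0 < β) (hF : G.IsCocoercive P ξ β) {bl : Dual N m} (hbl : ∑ i, bl i = G.b) :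
    ∃ p, IsVISolution G.kktSet (fun u => G.forward P ξ W bl u + skewMap G.A W u) p := by
  have hne : G.feasible.Nonempty := by
    obtain ⟨y, hy, hy'⟩ := hX.slater
    exact ⟨y, hy, fun r => (hy' r).le⟩
  have hc : IsCompact G.feasible :=
    hX.isCompact_localSet.of_isClosed_subset hX.isClosed_feasible fun _ h => h.1
  obtain ⟨x, hx, hmin⟩ := exists_isVISolution_of_cocoercive hc hne hX.convex_feasible hβ hF
  obtain ⟨l, hl, hcompl, hlag⟩ := hX.exists_multiplier hx hmin
  have hN : (N : ℝ) ≠ 0 := by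
    obtain ⟨i₀⟩ := hW.connected.nonempty
    exact_mod_cast i₀.pos.ne'
  -- The right-hand side sums to zero because `∑ b_i = b`. With this `z`, the dual residual of each
  -- agent is `(b - A x) / N`, which is nonnegative and complementary to `l`.
  obtain ⟨z, hz⟩ := hW.exists_lap_eq (v := (WithLp.toLp 2 fun i =>
    bl i - blockMap G.A x i + (N : ℝ)⁻¹ • (G.coupling x - G.b) : Stack N m)) (by
      simp only [Finset.sum_add_distrib, Finset.sum_sub_distrib, hbl, sum_blockMap,
        Finset.sum_const, Finset.card_univ, Fintype.card_fin, ← Nat.cast_smul_eq_nsmul ℝ, smul_smul,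
        mul_inv_cancel₀ hN, one_smul]
      abel)
  refine ⟨triple x z (WithLp.toLp 2 fun _ => l), ⟨hx.1, fun _ => hl⟩, fun y hy => ?_⟩
  simp only [forward, skewMap_apply, inner_ext, WithLp.sub_fst,
    WithLp.sub_snd, triple_fst, triple_snd_fst, triple_snd_snd, lap_const, zero_add,
    inner_zero_left, inner_add_left]
  have h1 := hlag y.fst hy.1
  rw [real_inner_comm (G.coupling _) l, inner_coupling] at h1
  have h2 : inner ℝ (WithLp.toLp 2 bl : Stack N m) (y.snd.snd - WithLp.toLp 2 fun _ => l)
      + inner ℝ (-blockMap G.A x - lap W z) (y.snd.snd - WithLp.toLp 2 fun _ => l)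
      = ∑ i, (N : ℝ)⁻¹ * inner ℝ (y.snd.snd i) (G.b - G.coupling x) := by
    rw [← inner_add_left, inner_stack]
    refine Finset.sum_congr rfl fun i _ => ?_
    rw [hz]
    simp only [PiLp.add_apply, PiLp.sub_apply, PiLp.neg_apply]
    have h3 : bl i + (-blockMap G.A x i - (bl i - blockMap G.A x i
        + (N : ℝ)⁻¹ • (G.coupling x - G.b))) = (N : ℝ)⁻¹ • (G.b - G.coupling x) := by module
    rw [h3, real_inner_smul_left, real_inner_comm, inner_sub_left, hcompl, sub_zero]
  have h4 : 0 ≤ ∑ i, (N : ℝ)⁻¹ * inner ℝ (y.snd.snd i) (G.b - G.coupling x) :=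
    Finset.sum_nonneg fun i _ => mul_nonneg (by positivity)
      (inner_nonneg_of_orthant (hy.2 i) fun r => sub_nonneg.2 (hx.2 r))
  linarith

/-- Testing in one variable at a time: `z` gives consensus of the multipliers, consensual `λ` gives
feasibility and complementarity, and `x` gives the Lagrangian inequality, in which the multiplier
term has the right sign on feasible points. -/
theorem solvesSVI_of_kkt (hW : GraphAssumption 𝒢 W) {bl : Dual N m} (hbl : ∑ i, bl i = G.b) {p : Ext n m}
    (hp : IsVISolution G.kktSet (fun u => G.forward P ξ W bl u + skewMap G.A W u) p) :
    G.SolvesSVI P ξ p.fst := by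
  obtain ⟨⟨hpx, hpl⟩, hp⟩ := hp
  obtain ⟨i₀⟩ := hW.connected.nonempty
  have hvi : ∀ x ∈ G.localSet, ∀ z l : Stack N m, (∀ i, l i ∈ orthant m) →
      0 ≤ inner ℝ (G.pseudograd P ξ p.fst + blockMapT G.A p.snd.snd) (x - p.fst)
        + (inner ℝ (lap W p.snd.snd) (z - p.snd.fst)
          + inner ℝ (lap W p.snd.snd + WithLp.toLp 2 bl
            + (-blockMap G.A p.fst - lap W p.snd.fst)) (l - p.snd.snd)) := fun x hx z l hl => by
    have h1 := hp (triple x z l) ⟨hx, hl⟩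
    simpa only [forward, skewMap_apply, inner_ext, WithLp.add_fst, WithLp.add_snd, WithLp.sub_fst,
      WithLp.sub_snd, triple_fst, triple_snd_fst, triple_snd_snd, zero_add] using h1
  -- As `z` is free, moving it by `-Lλ` yields `-‖Lλ‖² ≥ 0`.
  have hlap : lap W p.snd.snd = 0 := by
    have h1 := hvi p.fst hpx (p.snd.fst - lap W p.snd.snd) p.snd.snd hpl
    rw [sub_self, sub_self, inner_zero_right, inner_zero_right, zero_add, add_zero,
      sub_sub_cancel_left, inner_neg_right, real_inner_self_eq_norm_sq] at h1
    have h2 : ‖lap W p.snd.snd‖ ^ 2 = 0 := le_antisymm (by linarith) (sq_nonneg _)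
    simpa using h2
  set l := p.snd.snd i₀ with hl
  have hconst : p.snd.snd = WithLp.toLp 2 fun _ => l := by
    ext1 i
    exact hW.eq_of_lap_eq_zero hlap i i₀
  -- For equal dual test vectors the residuals are summed over agents, and the `L z` term disappears
  -- because Laplacians have zero sum.
  have hdual : ∀ q ∈ orthant m, 0 ≤ inner ℝ (G.b - G.coupling p.fst) (q - l) := fun q hq => by
    have h1 := hvi p.fst hpx p.snd.fst (WithLp.toLp 2 fun _ => q) fun _ => hq
    have h2 : (WithLp.toLp 2 fun _ => q : Stack N m) - (WithLp.toLp 2 fun _ => l)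
        = WithLp.toLp 2 fun _ => q - l := rfl
    rw [sub_self, sub_self, inner_zero_right, inner_zero_right, zero_add, zero_add, hlap, zero_add,
      hconst, h2, inner_stack] at h1
    simp only [← sum_inner, PiLp.add_apply, PiLp.sub_apply, PiLp.neg_apply] at h1
    simpa only [Finset.sum_add_distrib, Finset.sum_sub_distrib, Finset.sum_neg_distrib, hbl,
      sum_blockMap, sum_lap hW.symm, sub_zero, ← sub_eq_add_neg] using h1
  have hfeas : p.fst ∈ G.feasible := by
    refine ⟨hpx, fun r => ?_⟩
    have h1 := hdual (l + EuclideanSpace.single r 1) fun r' => by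
      have h2 := hpl i₀ r'
      rw [PiLp.add_apply, PiLp.single_apply]
      split_ifs <;> simp only [hl, add_zero] <;> linarith
    rw [add_sub_cancel_left, EuclideanSpace.inner_single_right] at h1
    simpa using h1
  have hcompl : inner ℝ (G.b - G.coupling p.fst) l ≤ 0 := by
    have h1 := hdual 0 fun _ => le_rfl
    rw [zero_sub, inner_neg_right] at h1
    linarith
  refine ⟨hfeas, fun y hy => ?_⟩
  have h1 := hvi y hy.1 p.snd.fst p.snd.snd hpl
  rw [sub_self, sub_self, inner_zero_right, inner_zero_right, add_zero, add_zero, inner_add_left,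
    hconst, ← inner_coupling, coupling_sub] at h1
  have h2 : 0 ≤ inner ℝ l (G.b - G.coupling y) :=
    inner_nonneg_of_orthant (hpl i₀) fun r => sub_nonneg.2 (hy.2 r)
  rw [real_inner_comm] at h2
  simp only [inner_sub_left] at h1 h2 hcompl
  linarith

end Game

theorem summable_const_div_batch {c k₀ a : ℝ} (hc : 0 < c) (hk₀ : 0 < k₀) (ha : 0 < a)
    {batch : ℕ → ℕ} (hbatch : ∀ k : ℕ, c * ((k : ℝ) + k₀) ^ (a + 1) ≤ (batch k : ℝ)) {t : ℝ}
    (ht : 0 ≤ t) : Summable fun k => t / (batch k : ℝ) := by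
  rw [← summable_nat_add_iff 1]
  have h1 : Summable fun k : ℕ => t / c * (1 / ((k + 1 : ℕ) : ℝ) ^ (a + 1)) :=
    ((summable_nat_add_iff 1).2 (Real.summable_one_div_nat_rpow.2 (by linarith))).mul_left _
  refine Summable.of_nonneg_of_le (fun k => by positivity) (fun k => ?_) h1
  have h2 : (0 : ℝ) < ((k + 1 : ℕ) : ℝ) := by positivity
  have h3 : ((k + 1 : ℕ) : ℝ) ^ (a + 1) ≤ (((k + 1 : ℕ) : ℝ) + k₀) ^ (a + 1) :=
    Real.rpow_le_rpow h2.le (by linarith) (by linarith)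
  have h4 : 0 < ((k + 1 : ℕ) : ℝ) ^ (a + 1) := Real.rpow_pos_of_pos h2 _
  have h5 : c * ((k + 1 : ℕ) : ℝ) ^ (a + 1) ≤ (batch (k + 1) : ℝ) :=
    (mul_le_mul_of_nonneg_left h3 hc.le).trans (hbatch (k + 1))
  rw [div_mul_div_comm, mul_one]
  exact div_le_div_of_nonneg_left ht (by positivity) h5

/-! ### Almost sure convergence of the noise sums. -/

section Martingale

variable {Ω : Type*} {m0 : MeasurableSpace Ω} {μ : Measure Ω}

/-- By Tonelli the whole series has finite expectation, so it is finite almost surely. -/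
theorem ae_summable_of_integral_le {f : ℕ → Ω → ℝ} (hf : ∀ k w, 0 ≤ f k w)
    (hint : ∀ k, Integrable (f k) μ) {B : ℕ → ℝ} (hB : Summable B)
    (hle : ∀ k, ∫ w, f k w ∂μ ≤ B k) : ∀ᵐ w ∂μ, Summable fun k => f k w := by
  have hm : ∀ k, AEMeasurable (fun w => ENNReal.ofReal (f k w)) μ := fun k =>
    (hint k).aestronglyMeasurable.aemeasurable.ennreal_ofReal
  have h1 : ∫⁻ w, ∑' k, ENNReal.ofReal (f k w) ∂μ ≠ ⊤ := by
    rw [lintegral_tsum hm]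
    refine ne_top_of_le_ne_top hB.tsum_ofReal_ne_top (ENNReal.tsum_le_tsum fun k => ?_)
    rw [← ofReal_integral_eq_lintegral_ofReal (hint k) (Eventually.of_forall (hf k))]
    exact ENNReal.ofReal_le_ofReal (hle k)
  filter_upwards [ae_lt_top' (AEMeasurable.tsum hm) h1] with w hw
  have h2 := ENNReal.summable_toReal hw.ne
  simpa only [ENNReal.toReal_ofReal (hf _ w)] using h2

variable [IsProbabilityMeasure μ]

/-- The partial sums form a martingale with orthogonal increments, so its second moments are bounded
by the partial sums of `B`. Since `|M| ≤ 1 + M²` it is bounded in `L¹`, and Doob's theorem applies.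
-/
theorem ae_tendsto_sum_of_condExp_eq_zero {ℱ : Filtration ℕ m0} {D : ℕ → Ω → ℝ}
    (hD : ∀ k, StronglyMeasurable[ℱ (k + 1)] (D k)) (hL2 : ∀ k, MemLp (D k) 2 μ)
    (hcond : ∀ k, μ[D k | ℱ k] =ᵐ[μ] 0) {B : ℕ → ℝ} (hB : Summable B)
    (hle : ∀ k, ∫ w, D k w ^ 2 ∂μ ≤ B k) :
    ∀ᵐ w ∂μ, ∃ l, Tendsto (fun j => ∑ k ∈ Finset.range j, D k w) atTop (𝓝 l) := by
  set M : ℕ → Ω → ℝ := fun j w => ∑ k ∈ Finset.range j, D k w with hM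
  have hMs : ∀ j, M (j + 1) = M j + D j := fun j => by
    funext w
    simp [hM, Finset.sum_range_succ]
  have hadp : StronglyAdapted ℱ M := fun j =>
    Finset.stronglyMeasurable_fun_sum _ fun k hk => (hD k).mono
      (ℱ.mono (Nat.succ_le_of_lt (Finset.mem_range.1 hk)))
  have hML2 : ∀ j, MemLp (M j) 2 μ := fun j => memLp_finsetSum _ fun k _ => hL2 k
  have hMint : ∀ j, Integrable (M j) μ := fun j => (hML2 j).integrable (by norm_num)
  have hDint : ∀ j, Integrable (D j) μ := fun j => (hL2 j).integrable (by norm_num)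
  have hmart : Martingale M ℱ μ := by
    refine martingale_nat hadp hMint fun j => ?_
    rw [hMs]
    refine EventuallyEq.symm ((condExp_add (hMint j) (hDint j) _).trans ?_)
    filter_upwards [hcond j] with w hw
    rw [Pi.add_apply, hw, condExp_of_stronglyMeasurable (ℱ.le j) (hadp j) (hMint j)]
    simp
  have horth : ∀ j, ∫ w, M j w * D j w ∂μ = 0 := fun j => by
    have hmul : Integrable (fun w => M j w * D j w) μ := (hML2 j).integrable_mul (hL2 j)
    rw [← integral_condExp (ℱ.le j)]
    have h1 := condExp_mul_of_stronglyMeasurable_left (hadp j) hmul (hDint j)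
    rw [← integral_zero Ω ℝ (μ := μ)]
    refine integral_congr_ae ?_
    filter_upwards [h1, hcond j] with w h2 h3
    have h4 := h2
    rw [Pi.mul_apply, h3, Pi.zero_apply, mul_zero] at h4
    exact h4
  have hvar : ∀ j, ∫ w, M j w ^ 2 ∂μ ≤ ∑ k ∈ Finset.range j, B k := fun j => by
    induction j with
    | zero => simp [hM]
    | succ j ih =>
      have h1 : ∫ w, M (j + 1) w ^ 2 ∂μ
          = ∫ w, M j w ^ 2 ∂μ + 2 * ∫ w, M j w * D j w ∂μ + ∫ w, D j w ^ 2 ∂μ := by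
        have h2 : Integrable (fun w => 2 * (M j w * D j w)) μ :=
          ((hML2 j).integrable_mul (hL2 j)).const_mul 2
        have h3 : Integrable (fun w => M j w ^ 2 + 2 * (M j w * D j w)) μ :=
          (hML2 j).integrable_sq.add h2
        rw [← integral_const_mul, ← integral_add (hML2 j).integrable_sq h2,
          ← integral_add h3 (hL2 j).integrable_sq]
        refine integral_congr_ae (Eventually.of_forall fun w => ?_)
        simp only [hMs, Pi.add_apply]
        ring
      rw [h1, horth, Finset.sum_range_succ]
      linarith [hle j]
  have hB0 : ∀ k, 0 ≤ B k := fun k => (integral_nonneg fun w => sq_nonneg _).trans (hle k)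
  refine hmart.submartingale.exists_ae_tendsto_of_bdd (R := (1 + ∑' k, B k).toNNReal) fun j => ?_
  rw [eLpNorm_one_eq_lintegral_enorm, ← ofReal_integral_norm_eq_lintegral_enorm (hMint j)]
  refine ENNReal.ofReal_le_ofReal ?_
  calc ∫ w, ‖M j w‖ ∂μ ≤ ∫ w, (1 + M j w ^ 2) ∂μ := by
        refine integral_mono (hMint j).norm ((integrable_const _).add (hML2 j).integrable_sq)
          fun w => ?_
        simp only [Real.norm_eq_abs, ← sq_abs (M j w)]
        nlinarith [sq_nonneg (|M j w| - 1), abs_nonneg (M j w)]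
    _ = 1 + ∫ w, M j w ^ 2 ∂μ := by
        rw [integral_add (integrable_const _) (hML2 j).integrable_sq]
        simp
    _ ≤ 1 + ∑' k, B k := by
        have := hB.sum_le_tsum (Finset.range j) fun k _ => hB0 k
        linarith [hvar j]

variable {E : Type*} [NormedAddCommGroup E] [InnerProductSpace ℝ E] [CompleteSpace E]

/-- A bounded factor that is known at time `k` can be taken out of the conditional expectation, so
the inner products are again square-integrable martingale increments. -/
theorem ae_tendsto_sum_inner {ℱ : Filtration ℕ m0} {ε Y : ℕ → Ω → E}
    (hε : ∀ k, StronglyMeasurable[ℱ (k + 1)] (ε k)) (hL2 : ∀ k, MemLp (ε k) 2 μ)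
    (hcond : ∀ k, μ[ε k | ℱ k] =ᵐ[μ] 0) {B : ℕ → ℝ} (hB : Summable B)
    (hle : ∀ k, ∫ w, ‖ε k w‖ ^ 2 ∂μ ≤ B k)
    (hY : ∀ k, StronglyMeasurable[ℱ k] (Y k)) {R : ℝ} (hR : ∀ k w, ‖Y k w‖ ≤ R) :
    ∀ᵐ w ∂μ, ∃ l, Tendsto (fun j => ∑ k ∈ Finset.range j, inner ℝ (ε k w) (Y k w))
      atTop (𝓝 l) := by
  have hbound : ∀ k w, ‖inner ℝ (ε k w) (Y k w)‖ ≤ R * ‖ε k w‖ := fun k w => by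
    rw [mul_comm]
    exact (norm_inner_le_norm _ _).trans (mul_le_mul_of_nonneg_left (hR k w) (norm_nonneg _))
  have hmeas : ∀ k, StronglyMeasurable[ℱ (k + 1)] fun w => inner ℝ (ε k w) (Y k w) := fun k =>
    (hε k).inner ((hY k).mono (ℱ.mono (Nat.le_succ k)))
  have hDL2 : ∀ k, MemLp (fun w => inner ℝ (ε k w) (Y k w)) 2 μ := fun k =>
    (hL2 k).of_le_mul ((hmeas k).mono (ℱ.le _)).aestronglyMeasurable
      (Eventually.of_forall (hbound k))
  refine ae_tendsto_sum_of_condExp_eq_zero hmeas hDL2 (fun k => ?_) (hB.mul_left (R ^ 2))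
    fun k => ?_
  · have h1 := condExp_bilin_of_stronglyMeasurable_right (μ := μ) (m := ℱ k) (innerSL ℝ)
      (f := ε k) (g := Y k) (hY k) ((hDL2 k).integrable (by norm_num))
      ((hL2 k).integrable (by norm_num))
    refine EventuallyEq.trans h1 ?_
    filter_upwards [hcond k] with w hw
    rw [hw]
    simp
  · calc ∫ w, inner ℝ (ε k w) (Y k w) ^ 2 ∂μ ≤ ∫ w, R ^ 2 * ‖ε k w‖ ^ 2 ∂μ := by
          refine integral_mono (hDL2 k).integrable_sq ((hL2 k).norm.integrable_sq.const_mul _)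
            fun w => ?_
          have h1 := hbound k w
          rw [Real.norm_eq_abs] at h1
          simp only [← sq_abs (inner ℝ (ε k w) (Y k w)), ← mul_pow]
          exact pow_le_pow_left₀ (abs_nonneg _) h1 2
      _ = R ^ 2 * ∫ w, ‖ε k w‖ ^ 2 ∂μ := integral_const_mul _ _
      _ ≤ R ^ 2 * B k := mul_le_mul_of_nonneg_left (hle k) (sq_nonneg _)

end Martingale

/-! ### Measurability of gradients and of one iteration. -/

theorem measurable_replace {N : ℕ} {n : Fin N → ℕ} (i : Fin N) :
    Measurable fun q : Profile n × Euc (n i) => replace q.1 i q.2 := by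
  refine Continuous.measurable ?_
  unfold replace
  refine (PiLp.continuous_toLp 2 _).comp ?_
  exact ((PiLp.continuous_ofLp 2 _).comp continuous_fst).update i continuous_snd

/-- All components of a random state are measurable. -/
structure MeasurableState {N m : ℕ} {n : Fin N → ℕ} {Ω' : Type*} (m' : MeasurableSpace Ω')
    (s : Ω' → State N m n) : Prop where
  x : Measurable fun w => (s w).x
  z : Measurable fun w => (s w).z
  l : Measurable fun w => (s w).l
  xPrev : Measurable fun w => (s w).xPrev
  lPrev : Measurable fun w => (s w).lPrev

theorem MeasurableState.mono {N m : ℕ} {n : Fin N → ℕ} {Ω' : Type*} {m₁ m₂ : MeasurableSpace Ω'}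
    {s : Ω' → State N m n} (hs : MeasurableState m₁ s) (h : m₁ ≤ m₂) : MeasurableState m₂ s :=
  ⟨hs.x.mono h le_rfl, hs.z.mono h le_rfl, hs.l.mono h le_rfl, hs.xPrev.mono h le_rfl,
    hs.lPrev.mono h le_rfl⟩

theorem MeasurableState.of_initVector {N m : ℕ} {n : Fin N → ℕ} {Ω' : Type*}
    {m' : MeasurableSpace Ω'} {s : Ω' → State N m n} (hs : Measurable (initVector s)) :
    MeasurableState m' s :=
  ⟨hs.fst, hs.snd.fst, hs.snd.snd.fst, hs.snd.snd.snd.fst, hs.snd.snd.snd.snd⟩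

theorem MeasurableState.xRefl {N m : ℕ} {n : Fin N → ℕ} {Ω' : Type*}
    {m' : MeasurableSpace Ω'} {s : Ω' → State N m n} (hs : MeasurableState m' s) :
    Measurable fun w => (s w).xRefl :=
  (hs.x.const_smul (2 : ℝ)).sub hs.xPrev

namespace Game

variable {N m d : ℕ} {n : Fin N → ℕ} {G : Game N m d n} {W : Matrix (Fin N) (Fin N) ℝ}
  {γ : StepSizes N} {bl : Dual N m}

section

variable {Ξ : Type*} [MeasurableSpace Ξ] {P : Measure Ξ} {ξ : Ξ → Euc d}

/-- Each coordinate is a pointwise limit of difference quotients, and these are jointly measurable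
because the costs are. -/
theorem CostAssumption.measurable_partialGrad (hJ : G.CostAssumption P ξ) (i : Fin N) :
    Measurable fun q : Profile n × Euc d => G.partialGrad i q.1 q.2 := by
  refine (WithLp.measurable_toLp 2 (Fin (n i) → ℝ)).comp
    (measurable_pi_lambda (fun q : Profile n × Euc d => WithLp.ofLp (G.partialGrad i q.1 q.2))
      fun r => ?_)
  set t : ℕ → ℝ := fun k => 1 / ((k : ℝ) + 1) with ht
  have htlim : Tendsto t atTop (𝓝[>] 0) :=
    tendsto_nhdsWithin_iff.2 ⟨tendsto_one_div_add_atTop_nhds_zero_nat,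
      Eventually.of_forall fun k => Set.mem_Ioi.2 Nat.one_div_pos_of_nat⟩
  refine measurable_of_tendsto_metrizable (f := fun k (q : Profile n × Euc d) =>
    (t k)⁻¹ * (G.J i (replace q.1 i (q.1 i + t k • EuclideanSpace.single r 1)) q.2
      - G.J i q.1 q.2)) (fun k => ?_) (tendsto_pi_nhds.2 fun q => ?_)
  · refine Measurable.const_mul (Measurable.sub ?_ (hJ.measurable i)) _
    refine (hJ.measurable i).comp (Measurable.prodMk ?_ measurable_snd)
    refine (measurable_replace i).comp (measurable_fst.prodMk ?_)
    have : Continuous fun q : Profile n × Euc d =>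
      q.1 i + t k • (EuclideanSpace.single r 1 : Euc (n i)) := by fun_prop
    exact this.measurable
  · have h1 := (hasDerivAt_line (hJ.differentiable i q.1 q.2 (q.1 i))
      (EuclideanSpace.single r 1)).tendsto_slope_zero_right.comp htlim
    rw [EuclideanSpace.inner_single_right] at h1
    simpa [partialGrad, Function.comp_def] using h1

variable (G) in
/-- The update of the decisions with the value `g` in place of the pseudogradient. -/
def nextX (γ : StepSizes N) (s : State N m n) (g : Profile n) : Profile n :=
  WithLp.toLp 2 fun i => proj (G.Ω i) (s.x i - γ.α i • (g i + mulE (G.A i)ᵀ (s.l i)))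

theorem ConstraintAssumption.nextX_mem (hX : G.ConstraintAssumption) (s : State N m n)
    (g : Profile n) : G.nextX γ s g ∈ G.localSet := fun i =>
  (proj_spec (hX.nonempty i) (hX.compact i).isClosed (hX.convex i) _).1

/-- Projections are nonexpansive, so the sampling error shifts the new decision by `O(‖ε‖)`; the sum
of the `α_i` serves as a crude bound for each of them. -/
theorem ConstraintAssumption.norm_nextX_sub_le (hX : G.ConstraintAssumption)
    (hα : ∀ i, 0 < γ.α i) (s : State N m n) (g g' : Profile n) :
    ‖G.nextX γ s g - G.nextX γ s g'‖ ≤ (∑ i, γ.α i) * ‖g - g'‖ := by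
  have hsum : 0 ≤ ∑ i, γ.α i := Finset.sum_nonneg fun i _ => (hα i).le
  refine le_of_sq_le_sq ?_ (mul_nonneg hsum (norm_nonneg _))
  rw [mul_pow, PiLp.norm_sq_eq_of_L2, PiLp.norm_sq_eq_of_L2, Finset.mul_sum]
  refine Finset.sum_le_sum fun i _ => ?_
  rw [← mul_pow]
  refine pow_le_pow_left₀ (norm_nonneg _) ?_ 2
  refine (proj_lipschitz (hX.nonempty i) (hX.compact i).isClosed (hX.convex i) _ _).trans ?_
  have h1 : s.x i - γ.α i • (g i + mulE (G.A i)ᵀ (s.l i))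
      - (s.x i - γ.α i • (g' i + mulE (G.A i)ᵀ (s.l i))) = -(γ.α i • (g i - g' i)) := by module
  rw [h1, norm_neg, norm_smul, Real.norm_of_nonneg (hα i).le]
  exact mul_le_mul_of_nonneg_right
    (Finset.single_le_sum (fun i _ => (hα i).le) (Finset.mem_univ i)) (norm_nonneg _)

end

section

variable {Ω' : Type*} {m' : MeasurableSpace Ω'} {s : Ω' → State N m n}

theorem measurable_block {q : Fin N → ℕ} {x : Ω' → Profile q} (hx : Measurable x) (i : Fin N) :
    Measurable fun w => x w i :=
  ((measurable_pi_apply i).comp (WithLp.measurable_ofLp 2 _)).comp hx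

theorem measurable_of_blocks {q : Fin N → ℕ} {x : Ω' → (i : Fin N) → Euc (q i)}
    (hx : ∀ i, Measurable fun w => x w i) :
    Measurable fun w => (WithLp.toLp 2 (x w) : Profile q) :=
  (WithLp.measurable_toLp 2 _).comp (measurable_pi_lambda _ hx)

theorem measurable_mulE {p q : ℕ} (M : Matrix (Fin p) (Fin q) ℝ) : Measurable (mulE M) :=
  (continuous_mulE M).measurable

theorem ConstraintAssumption.measurable_nextX (hX : G.ConstraintAssumption)
    (hs : MeasurableState m' s) {g : Ω' → Profile n} (hg : Measurable g) :
    Measurable fun w => G.nextX γ (s w) (g w) := by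
  refine measurable_of_blocks fun i => ?_
  refine (continuous_proj (hX.nonempty i) (hX.compact i).isClosed
    (hX.convex i)).measurable.comp ?_
  have h1 := (measurable_mulE (G.A i)ᵀ).comp ((measurable_pi_apply i).comp hs.l)
  exact (measurable_block hs.x i).sub (((measurable_block hg i).add h1).const_smul (γ.α i))

theorem ConstraintAssumption.measurableState_step (hX : G.ConstraintAssumption)
    (hs : MeasurableState m' s) {F : Ω' → Profile n → Profile n}
    (hF : Measurable fun w => F w (s w).xRefl) :
    MeasurableState m' fun w => G.step W γ bl (F w) (s w) := by
  have hx : Measurable fun w => G.nextX γ (s w) (F w (s w).xRefl) := hX.measurable_nextX hs hF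
  have hli : ∀ i, Measurable fun w => (s w).l i := fun i => (measurable_pi_apply i).comp hs.l
  have hzi : ∀ i, Measurable fun w => (s w).z i := fun i => (measurable_pi_apply i).comp hs.z
  have hpi : ∀ i, Measurable fun w => (s w).lRefl i := fun i =>
    ((hli i).const_smul (2 : ℝ)).sub ((measurable_pi_apply i).comp hs.lPrev)
  have hzi' : ∀ i, Measurable fun w => (G.step W γ bl (F w) (s w)).z i := fun i =>
    (hzi i).sub ((Finset.measurable_fun_sum _ fun j _ =>
      ((hli i).sub (hli j)).const_smul (W i j)).const_smul (γ.ν i))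
  have hli' : ∀ i, Measurable fun w => (G.step W γ bl (F w) (s w)).l i := fun i => by
    have h1 : Measurable fun w => mulE (G.A i)
        ((2 : ℝ) • G.nextX γ (s w) (F w (s w).xRefl) i - (s w).x i) :=
      (measurable_mulE (G.A i)).comp
        (((measurable_block hx i).const_smul (2 : ℝ)).sub (measurable_block hs.x i))
    have h2 : Measurable fun w => ∑ j, W i j • ((2 : ℝ) • ((G.step W γ bl (F w) (s w)).z i
        - (G.step W γ bl (F w) (s w)).z j) - ((s w).z i - (s w).z j)) :=
      Finset.measurable_fun_sum _ fun j _ => ((((hzi' i).sub (hzi' j)).const_smul (2 : ℝ)).sub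
        ((hzi i).sub (hzi j))).const_smul (W i j)
    have h3 : Measurable fun w => ∑ j, W i j • ((s w).lRefl i - (s w).lRefl j) :=
      Finset.measurable_fun_sum _ fun j _ => ((hpi i).sub (hpi j)).const_smul (W i j)
    have h4 := (continuous_proj (orthant_nonempty m) (isClosed_orthant m)
      (convex_orthant m)).measurable
    have h5 := (((hli i).add ((h1.sub_const (bl i)).const_smul (γ.σ i))).add
      (h2.const_smul (γ.σ i))).sub (h3.const_smul (γ.σ i))
    exact h4.comp h5
  exact ⟨hx, measurable_pi_lambda _ hzi', measurable_pi_lambda _ hli', hs.x, hs.l⟩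

end

end Game

/-! ### The filtration and adaptedness of the iterates. -/

section Information

variable {N m d : ℕ} {n : Fin N → ℕ} {Ξ : Type*} {batch : ℕ → ℕ}
  {sample : (k : ℕ) → Fin N → Fin (batch k) → Ξ → Euc d} {init : Ξ → State N m n}

theorem measurable_initVector_info (k : ℕ) :
    Measurable[info sample init k] (initVector init) :=
  (comap_measurable _).mono le_sup_left le_rfl

theorem measurable_sample_info {j k : ℕ} (h : j < k) (i : Fin N) (t : Fin (batch j)) :
    Measurable[info sample init k] (sample j i t) := by
  refine (comap_measurable _).mono (le_trans ?_ le_sup_right) le_rfl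
  exact le_iSup_of_le j (le_iSup_of_le h (le_iSup_of_le i (le_iSup_of_le t le_rfl)))

theorem info_mono {j k : ℕ} (h : j ≤ k) : info sample init j ≤ info sample init k :=
  sup_le (measurable_initVector_info k).comap_le (iSup_le fun _ => iSup_le fun hl =>
    iSup_le fun i => iSup_le fun t => (measurable_sample_info (hl.trans_le h) i t).comap_le)

/-- The filtration of the available information. -/
def infoFiltration [m0 : MeasurableSpace Ξ] (hinit : Measurable (initVector init))
    (hsample : ∀ k i t, Measurable (sample k i t)) : Filtration ℕ m0 where
  seq := info sample init
  mono' _ _ h := info_mono h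
  le' _ := sup_le hinit.comap_le (iSup_le fun j => iSup_le fun _ => iSup_le fun i =>
    iSup_le fun t => (hsample j i t).comap_le)

namespace Game

variable {G : Game N m d n} {W : Matrix (Fin N) (Fin N) ℝ} {γ : StepSizes N} {bl : Dual N m}
  [MeasurableSpace Ξ] {P : Measure Ξ} {ξ : Ξ → Euc d}

theorem CostAssumption.measurable_sampleAverage (hJ : G.CostAssumption P ξ) {Ω' : Type*}
    {m' : MeasurableSpace Ω'} {sample : (k : ℕ) → Fin N → Fin (batch k) → Ω' → Euc d} {k : ℕ}
    {x : Ω' → Profile n} (hx : Measurable x) (hs : ∀ i t, Measurable (sample k i t)) :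
    Measurable fun w => G.sampleAverage sample k w (x w) := by
  refine measurable_of_blocks fun i => ?_
  have h1 : ∀ t, Measurable fun w => G.partialGrad i (x w) (sample k i t w) := fun t =>
    (hJ.measurable_partialGrad i).comp (hx.prodMk (hs i t))
  exact (Finset.measurable_fun_sum Finset.univ fun t _ => h1 t).const_smul (batch k : ℝ)⁻¹

/-- The samples of iteration `k` enter the information only at `k + 1`, as does the state computed
from them. -/
theorem CostAssumption.measurableState_iterate (hJ : G.CostAssumption P ξ)
    (hX : G.ConstraintAssumption) (k : ℕ) :
    MeasurableState (info sample init k) (G.iterate sample W γ bl init k) := by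
  induction k with
  | zero => exact .of_initVector (measurable_initVector_info 0)
  | succ k ih =>
    have h1 := ih.mono (info_mono (Nat.le_succ k))
    exact hX.measurableState_step h1 (hJ.measurable_sampleAverage h1.xRefl
      fun i t => measurable_sample_info (Nat.lt_succ_self k) i t)

end Game

end Information

/-! ### From the algorithm to the abstract iteration. -/

section Convergence

variable {N m d : ℕ} {n : Fin N → ℕ}

/-- The triple `(x, z, λ)` of a state. -/
def State.toExt (s : State N m n) : Ext n m := triple s.x (WithLp.toLp 2 s.z) (WithLp.toLp 2 s.l)

theorem norm_triple_zero (x : Profile n) : ‖(triple x 0 0 : Ext n m)‖ = ‖x‖ := by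
  have h : ‖(triple x 0 0 : Ext n m)‖ ^ 2 = ‖x‖ ^ 2 := by simp [norm_ext_sq]
  exact (sq_eq_sq₀ (norm_nonneg _) (norm_nonneg _)).1 h

theorem exists_tendsto_sum_range_succ {f : ℕ → ℝ}
    (h : ∃ l, Tendsto (fun j => ∑ k ∈ Finset.range j, f k) atTop (𝓝 l)) :
    ∃ l, Tendsto (fun j => ∑ k ∈ Finset.range j, f (k + 1)) atTop (𝓝 l) := by
  obtain ⟨l, hl⟩ := h
  refine ⟨l - f 0, (((tendsto_add_atTop_iff_nat 1).2 hl).sub_const (f 0)).congr fun j => ?_⟩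
  rw [Finset.sum_range_succ', add_sub_cancel_right]

namespace Game

variable {G : Game N m d n} {𝒢 : SimpleGraph (Fin N)} {W : Matrix (Fin N) (Fin N) ℝ}
  {γ : StepSizes N} {bl : Dual N m} {Ξ : Type*} [MeasurableSpace Ξ] {P : Measure Ξ} {ξ : Ξ → Euc d}

theorem ConstraintAssumption.step_mem_kktSet (hX : G.ConstraintAssumption)
    (F : Profile n → Profile n) (s : State N m n) : (G.step W γ bl F s).toExt ∈ G.kktSet :=
  ⟨hX.nextX_mem s _, fun _ =>
    (proj_spec (orthant_nonempty m) (isClosed_orthant m) (convex_orthant m) _).1⟩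

/-- Up to the inverse step sizes, the components are the optimality conditions of the two
projections and the exact update of `z`. The off-diagonal blocks of `Ψ` are chosen so that, combined
with `S` at the new point, they leave the old `λ` in the `x` update and `2 x' - x`, `2 z' - z` in
the `λ` update, which makes the step explicit. -/
theorem ConstraintAssumption.step_inner_le (hX : G.ConstraintAssumption)
    (hα : ∀ i, 0 < γ.α i) (hν : ∀ i, 0 < γ.ν i) (hσ : ∀ i, 0 < γ.σ i)
    (F : Profile n → Profile n) (s : State N m n) {v : Ext n m} (hv : v.fst = s.xRefl)
    (hv' : v.snd.snd = WithLp.toLp 2 s.lRefl) {y : Ext n m} (hy : y ∈ G.kktSet) :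
    inner ℝ (precondMap G.A W γ (s.toExt - (G.step W γ bl F s).toExt) - G.forward P ξ W bl v
      - triple (F s.xRefl - G.pseudograd P ξ s.xRefl) 0 0
      - skewMap G.A W (G.step W γ bl F s).toExt) (y - (G.step W γ bl F s).toExt) ≤ 0 := by
  set s' := G.step W γ bl F s with hs'
  have hx : ∀ i, inner ℝ (s.x i - γ.α i • (F s.xRefl i + mulE (G.A i)ᵀ (s.l i)) - s'.x i)
      (y.fst i - s'.x i) ≤ 0 := fun i =>
    (proj_spec (hX.nonempty i) (hX.compact i).isClosed (hX.convex i) _).2 _ (hy.1 i)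
  have hl : ∀ i, inner ℝ (s.l i + γ.σ i • (mulE (G.A i) ((2 : ℝ) • s'.x i - s.x i) - bl i)
      + γ.σ i • ∑ j, W i j • ((2 : ℝ) • (s'.z i - s'.z j) - (s.z i - s.z j))
      - γ.σ i • ∑ j, W i j • (s.lRefl i - s.lRefl j) - s'.l i) (y.snd.snd i - s'.l i) ≤ 0 :=
    fun i => (proj_spec (orthant_nonempty m) (isClosed_orthant m) (convex_orthant m) _).2 _ (hy.2 i)
  have hz : ∀ i, s'.z i = s.z i - γ.ν i • ∑ j, W i j • (s.l i - s.l j) := fun i => rfl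
  have e1 : scale (fun i => (γ.α i)⁻¹) (s.x - s'.x)
      - blockMapT G.A (WithLp.toLp 2 s.l - WithLp.toLp 2 s'.l) - G.pseudograd P ξ s.xRefl
      - (F s.xRefl - G.pseudograd P ξ s.xRefl) - blockMapT G.A (WithLp.toLp 2 s'.l)
      = WithLp.toLp 2 fun i => (γ.α i)⁻¹ •
        (s.x i - γ.α i • (F s.xRefl i + mulE (G.A i)ᵀ (s.l i)) - s'.x i) := by
    ext1 i
    have h0 := inv_smul_smul₀ (hα i).ne' (F s.xRefl i + mulE (G.A i)ᵀ (s.l i))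
    simp only [PiLp.sub_apply, scale_apply, blockMapT_apply, mulE_sub, smul_sub, h0]
    abel
  have e2 : scale (fun i => (γ.ν i)⁻¹) (WithLp.toLp 2 s.z - WithLp.toLp 2 s'.z)
      - lap W (WithLp.toLp 2 s.l - WithLp.toLp 2 s'.l) - 0 - 0
      - lap W (WithLp.toLp 2 s'.l) = (0 : Stack N m) := by
    ext1 i
    rw [map_sub (lap W)]
    simp only [PiLp.sub_apply, scale_apply, lap_apply, hz, sub_sub_cancel,
      inv_smul_smul₀ (hν i).ne', PiLp.zero_apply]
    abel
  have e3 : scale (fun i => (γ.σ i)⁻¹) (WithLp.toLp 2 s.l - WithLp.toLp 2 s'.l)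
      - blockMap G.A (s.x - s'.x) - lap W (WithLp.toLp 2 s.z - WithLp.toLp 2 s'.z)
      - (lap W (WithLp.toLp 2 s.lRefl) + WithLp.toLp 2 bl) - 0
      - (-(blockMap G.A s'.x) - lap W (WithLp.toLp 2 s'.z)) = (WithLp.toLp 2 fun i => (γ.σ i)⁻¹ •
        (s.l i + γ.σ i • (mulE (G.A i) ((2 : ℝ) • s'.x i - s.x i) - bl i)
        + γ.σ i • ∑ j, W i j • ((2 : ℝ) • (s'.z i - s'.z j) - (s.z i - s.z j))
        - γ.σ i • ∑ j, W i j • (s.lRefl i - s.lRefl j) - s'.l i) : Stack N m) := by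
    ext1 i
    have h1 : ∑ j, W i j • ((2 : ℝ) • (s'.z i - s'.z j) - (s.z i - s.z j))
        = (2 : ℝ) • ∑ j, W i j • (s'.z i - s'.z j) - ∑ j, W i j • (s.z i - s.z j) := by
      simp only [smul_sub, Finset.sum_sub_distrib, Finset.smul_sum, smul_comm (2 : ℝ)]
    rw [map_sub (blockMap G.A), map_sub (lap W)]
    simp only [PiLp.sub_apply, PiLp.add_apply, PiLp.neg_apply, PiLp.zero_apply, scale_apply,
      lap_apply, blockMap_apply, mulE_sub, mulE_smul, smul_sub (γ.σ i)⁻¹, smul_add (γ.σ i)⁻¹,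
      inv_smul_smul₀ (hσ i).ne', h1]
    module
  have key : precondMap G.A W γ (s.toExt - s'.toExt) - G.forward P ξ W bl v
      - triple (F s.xRefl - G.pseudograd P ξ s.xRefl) 0 0 - skewMap G.A W s'.toExt
      = triple (WithLp.toLp 2 fun i => (γ.α i)⁻¹ •
          (s.x i - γ.α i • (F s.xRefl i + mulE (G.A i)ᵀ (s.l i)) - s'.x i)) 0
        (WithLp.toLp 2 fun i => (γ.σ i)⁻¹ •
          (s.l i + γ.σ i • (mulE (G.A i) ((2 : ℝ) • s'.x i - s.x i) - bl i)
          + γ.σ i • ∑ j, W i j • ((2 : ℝ) • (s'.z i - s'.z j) - (s.z i - s.z j))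
          - γ.σ i • ∑ j, W i j • (s.lRefl i - s.lRefl j) - s'.l i)) := by
    rw [forward, hv, hv']
    exact ext_of_components e1 e2 e3
  rw [key, inner_ext, triple_fst, triple_snd_fst, triple_snd_snd, inner_zero_left, zero_add,
    inner_profile, inner_stack, ← Finset.sum_add_distrib]
  refine Finset.sum_nonpos fun i _ => add_nonpos ?_ ?_
  · rw [real_inner_smul_left]
    exact mul_nonpos_of_nonneg_of_nonpos (inv_nonneg.2 (hα i).le) (hx i)
  · rw [real_inner_smul_left]
    exact mul_nonpos_of_nonneg_of_nonpos (inv_nonneg.2 (hσ i).le) (hl i)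

/-- A statement about one realization `w`: the three error hypotheses are all that the convergence
proof needs from probability. -/
theorem iterate_tendsto_of_errors (hJ : G.CostAssumption P ξ) (hX : G.ConstraintAssumption)
    (hW : GraphAssumption 𝒢 W) (hbl : ∑ i, bl i = G.b) {β : ℝ} (hβ : 0 < β)
    (hF : G.IsCocoercive P ξ β) {θ τ : ℝ} (hγ : StepAssumption G.A W β θ τ γ) {batch : ℕ → ℕ}
    {sample : (k : ℕ) → Fin N → Fin (batch k) → Ξ → Euc d} {init : Ξ → State N m n} {w : Ξ}
    (hsq : Summable fun k => ‖G.error sample P ξ W γ bl init k w‖ ^ 2)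
    (hlin : ∀ p : Profile n, ∃ l, Tendsto (fun j => ∑ k ∈ Finset.range j,
      inner ℝ (G.error sample P ξ W γ bl init k w) p) atTop (𝓝 l))
    (hnext : ∃ l, Tendsto (fun j => ∑ k ∈ Finset.range j,
      inner ℝ (G.error sample P ξ W γ bl init k w)
        (G.nextX γ (G.iterate sample W γ bl init k w)
          (G.pseudograd P ξ (G.iterate sample W γ bl init k w).xRefl))) atTop (𝓝 l)) :
    ∃ xs : Profile n, G.IsVariationalSGNE P ξ xs ∧
      Tendsto (fun k => (G.iterate sample W γ bl init k w).x) atTop (𝓝 xs) := by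
  set ε := fun k => G.error sample P ξ W γ bl init k w with hε
  set st := fun k => G.iterate sample W γ bl init k w with hst
  have hstep : ∀ k, st (k + 1) = G.step W γ bl (G.sampleAverage sample k w) (st k) := fun _ => rfl
  have hε0 : Tendsto ε atTop (𝓝 0) := by
    have h2 := (Real.continuous_sqrt.tendsto 0).comp hsq.tendsto_atTop_zero
    rw [Real.sqrt_zero] at h2
    exact tendsto_zero_iff_norm_tendsto_zero.2
      (h2.congr fun k => by simp [hε, Real.sqrt_sq (norm_nonneg _)])
  -- The part of the new decision caused by the noise is `O(‖ε k‖)`, so its inner product with `ε k`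
  -- is dominated by the summable `‖ε k‖²`.
  have hquad : ∃ l, Tendsto (fun j => ∑ k ∈ Finset.range j, inner ℝ (ε k)
      ((st (k + 1)).x - G.nextX γ (st k) (G.pseudograd P ξ (st k).xRefl))) atTop (𝓝 l) := by
    have hs : Summable fun k => inner ℝ (ε k)
        ((st (k + 1)).x - G.nextX γ (st k) (G.pseudograd P ξ (st k).xRefl)) := by
      refine Summable.of_norm_bounded (hsq.mul_left (∑ i, γ.α i)) fun k => ?_
      refine (norm_inner_le_norm _ _).trans ?_
      have h1 := hX.norm_nextX_sub_le hγ.α_pos (st k) (G.sampleAverage sample k w (st k).xRefl)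
        (G.pseudograd P ξ (st k).xRefl)
      have h2 := mul_le_mul_of_nonneg_left h1 (norm_nonneg (ε k))
      calc _ ≤ ‖ε k‖ * ((∑ i, γ.α i) * ‖ε k‖) := h2
        _ = _ := by ring
    exact ⟨_, hs.hasSum.tendsto_sum_nat⟩
  obtain ⟨p, hp, hlim⟩ := reflected_forward_backward_tendsto (K := G.kktSet) hX.isClosed_kktSet
    hγ.θ_pos (isSymmetric_precondMap (A := G.A) hW.symm γ) (le_inner_precondMap hW hγ)
    (inner_skewMap_self hW.symm)
    (forward_cocoercive hW hF hγ.θ_pos hγ.θ_le hγ.θ_deg bl) (hX.exists_kkt hW hβ hF hbl)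
    -- The errors are shifted by one because the first iteration reflects through the arbitrary
    -- initial `xPrev` and `lPrev`; only from the second one on is the reflected point `2 u (k + 1)
    -- - u k`.
    (u := fun k => (st k).toExt) (e := fun k => triple (ε (k + 1)) 0 0)
    (fun k => hX.step_mem_kktSet _ (st (k + 1)))
    (fun k y hy => hX.step_inner_le hγ.α_pos hγ.ν_pos hγ.σ_pos
      (G.sampleAverage sample (k + 1) w) (st (k + 1)) rfl rfl hy)
    (by
      rw [tendsto_zero_iff_norm_tendsto_zero]
      simp only [norm_triple_zero]
      exact ((tendsto_add_atTop_iff_nat 1).2 hε0).norm.trans (by simp))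
    -- The new decision minus `p` is split into the noise-induced displacement, the exact update and
    -- the fixed vector `p`; the error has no `z` and `λ` components.
    (fun p _ => by
      obtain ⟨l₁, h₁⟩ := exists_tendsto_sum_range_succ hquad
      obtain ⟨l₂, h₂⟩ := exists_tendsto_sum_range_succ hnext
      obtain ⟨l₃, h₃⟩ := exists_tendsto_sum_range_succ (hlin p.fst)
      refine ⟨l₁ + l₂ - l₃, ((h₁.add h₂).sub h₃).congr fun j => ?_⟩
      rw [← Finset.sum_add_distrib, ← Finset.sum_sub_distrib]
      refine Finset.sum_congr rfl fun k _ => ?_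
      rw [← inner_add_right, ← inner_sub_right, inner_ext]
      simp [State.toExt, hε, hst])
  refine ⟨p.fst, hJ.isVariationalSGNE (solvesSVI_of_kkt hW hbl hp), ?_⟩
  have hc : Continuous fun u : Ext n m => u.fst :=
    continuous_fst.comp (WithLp.prod_continuous_ofLp 2 _ _)
  exact (hc.tendsto p).comp hlim

end Game

end Convergence

end SGNEP

end

/-! ### The almost sure statement. -/

theorem mainTheorem2 {N m d : ℕ} {n : Fin N → ℕ} (G : SGNEP.Game N m d n)
    {Ξ : Type*} [MeasurableSpace Ξ] (P : Measure Ξ) [IsProbabilityMeasure P]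
    (ξ : Ξ → SGNEP.Euc d) (hξ : Measurable ξ)
    -- costs and constraints
    (hJ : G.CostAssumption P ξ) (hX : G.ConstraintAssumption)
    -- communication graph and the splitting of `b` among the agents
    (𝒢 : SimpleGraph (Fin N)) (W : Matrix (Fin N) (Fin N) ℝ)
    (hW : SGNEP.GraphAssumption 𝒢 W)
    (bl : SGNEP.Dual N m) (hbl : ∑ i, bl i = G.b)
    -- cocoercivity and step sizes
    (β : ℝ) (hβ : 0 < β) (hF : G.IsCocoercive P ξ β)
    (θ τ : ℝ) (γ : SGNEP.StepSizes N) (hγ : SGNEP.StepAssumption G.A W β θ τ γ)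
    -- samples
    (batch : ℕ → ℕ) (sample : (k : ℕ) → Fin N → Fin (batch k) → Ξ → SGNEP.Euc d)
    (hsample : SGNEP.SamplingAssumption P ξ sample)
    -- initialization
    (init : Ξ → SGNEP.State N m n) (hinit : Measurable (SGNEP.initVector init))
    (hx0 : ∀ w, (init w).x ∈ G.localSet) (hl0 : ∀ w i, (init w).l i ∈ SGNEP.orthant m)
    -- unbiased error, growing batches and variance reduction
    (herr2 : ∀ k, MemLp (G.error sample P ξ W γ bl init k) 2 P)
    (herr : ∀ k, P[G.error sample P ξ W γ bl init k | SGNEP.info sample init k] =ᵐ[P] 0)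
    (c k₀ a : ℝ) (hc : 0 < c) (hk₀ : 0 < k₀) (ha : 0 < a)
    (hbatch : ∀ k : ℕ, c * ((k : ℝ) + k₀) ^ (a + 1) ≤ (batch k : ℝ))
    (C s : ℝ) (hC : 0 < C)
    (hvar : ∀ k, P[fun w => ‖G.error sample P ξ W γ bl init k w‖ ^ 2 |
      SGNEP.info sample init k] ≤ᵐ[P] fun _ => C * s ^ 2 / (batch k : ℝ)) :
    ∀ᵐ w ∂P, ∃ xs : SGNEP.Profile n, G.IsVariationalSGNE P ξ xs ∧
      Tendsto (fun k => (G.iterate sample W γ bl init k w).x) atTop (𝓝 xs) := by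
  set ℱ := SGNEP.infoFiltration hinit hsample.measurable with hℱ
  have hst : ∀ k, SGNEP.MeasurableState (ℱ k) (G.iterate sample W γ bl init k) :=
    fun k => hJ.measurableState_iterate hX k
  have hFc : Continuous (G.pseudograd P ξ) := SGNEP.continuous_of_cocoercive hβ hF
  have hεm : ∀ k, StronglyMeasurable[ℱ (k + 1)] (G.error sample P ξ W γ bl init k) := fun k => by
    have h1 := ((hst k).mono (ℱ.mono (Nat.le_succ k))).xRefl
    have h2 := hJ.measurable_sampleAverage (sample := sample) (k := k) h1
      fun i t => SGNEP.measurable_sample_info (Nat.lt_succ_self k) i t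
    exact (h2.sub (hFc.measurable.comp h1)).stronglyMeasurable
  have hB : Summable fun k => C * s ^ 2 / (batch k : ℝ) :=
    SGNEP.summable_const_div_batch hc hk₀ ha hbatch (by positivity)
  have hle : ∀ k, ∫ w, ‖G.error sample P ξ W γ bl init k w‖ ^ 2 ∂P
      ≤ C * s ^ 2 / (batch k : ℝ) := fun k => by
    rw [← integral_condExp (ℱ.le k)]
    refine (integral_mono_ae integrable_condExp (integrable_const _) (hvar k)).trans ?_
    simp
  -- Finitely many basis vectors suffice: one null set then serves all `p` by linearity.
  have hlin : ∀ᵐ w ∂P, ∀ r, ∃ l, Tendsto (fun j => ∑ k ∈ Finset.range j,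
      inner ℝ (G.error sample P ξ W γ bl init k w)
        (stdOrthonormalBasis ℝ (SGNEP.Profile n) r)) atTop (𝓝 l) :=
    ae_all_iff.2 fun r => SGNEP.ae_tendsto_sum_inner hεm herr2 herr hB hle
      (fun k => stronglyMeasurable_const)
      (fun k w => ((stdOrthonormalBasis ℝ (SGNEP.Profile n)).norm_eq_one r).le)
  obtain ⟨R, hR⟩ := hX.isCompact_localSet.isBounded.exists_norm_le
  -- The exact update is measurable before the samples of iteration `k` are drawn and takes values
  -- in the compact `Ω`, hence is a bounded predictable factor.
  have hnext := SGNEP.ae_tendsto_sum_inner hεm herr2 herr hB hle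
    (Y := fun k w => G.nextX γ (G.iterate sample W γ bl init k w)
      (G.pseudograd P ξ (G.iterate sample W γ bl init k w).xRefl))
    (fun k => (hX.measurable_nextX (hst k)
      (hFc.measurable.comp (hst k).xRefl)).stronglyMeasurable)
    (fun k w => hR _ (hX.nextX_mem _ _))
  have hsq := SGNEP.ae_summable_of_integral_le (fun k w => sq_nonneg _)
    (fun k => (herr2 k).norm.integrable_sq) hB hle
  filter_upwards [hlin, hnext, hsq] with w h1 h2 h3
  refine SGNEP.Game.iterate_tendsto_of_errors hJ hX hW hbl hβ hF hγ h3 (fun p => ?_) h2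
  choose l hl using h1
  refine ⟨∑ r, l r * inner ℝ (stdOrthonormalBasis ℝ (SGNEP.Profile n) r) p,
    (tendsto_finsetSum _ fun r _ => (hl r).mul_const _).congr fun j => ?_⟩
  simp only [Finset.sum_mul]
  rw [Finset.sum_comm]
  exact Finset.sum_congr rfl fun k _ =>
    (stdOrthonormalBasis ℝ (SGNEP.Profile n)).sum_inner_mul_inner _ _
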